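/- A partition is an $n$-core if no hook length of its Young diagram is a multiple of $n$, and an $(s,ms-1,ms+1)$-core if it is an $s$-core, an $(ms-1)$-core and an $(ms+1)$-core. The $\beta$-set of a partition is the set of hook lengths of the boxes in the first column of its Young diagram. For positive integers $s,m$ let $\mathcal L_m(s)=P_1\cup\dots\cup P_m$, where $P_k=\{\,msi+j : i,j\ge 0,\ (k-1)s+1+i\le j\le ks-1-i\,\}$ for $1\le k\le m-1$ and $P_m=\{\,msi+j : i,j\ge 0,\ (m-1)s+1+i\le j\le ms-2-i\,\}$. **Theorem.** Let $s,m\ge 1$ be integers. The largest size of an $(s,ms-1,ms+1)$-core partition is $$\frac{m^2t(t-1)(t^2-t+1)}{6}\quad\text{if } s=2t-1,\qquad \frac{m^2(t-1)^2(t^2-2t+3)}{6}-\frac{m(t-1)^2}{2}\quad\text{if } s=2t-2.$$ There is a partition $\lambda$ with $\beta$-set $\mathcal L_m(s)$, and the $(s,ms-1,ms+1)$-core partitions of largest size are precisely $\lambda$ and its conjugate. If $s\ge 3$, and moreover $m\ge 2$ or $s$ is even, then $\lambda$ is not self-conjugate, so that there are exactly two partitions of largest size. -/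

import Mathlib

namespace CorePartition

/-- Partitions are Young diagrams in English notation, with rows and columns indexed from `0`:
the parts are the row lengths, the size is the number of cells, the conjugate is the transpose.
The hook length of the cell `(i, j)` of `μ`: the number of cells of `μ` strictly to its right,
plus the number of cells strictly below it, plus one for the cell itself. -/
def hookLength (μ : YoungDiagram) (i j : ℕ) : ℕ :=
  (μ.rowLen i - (j + 1)) + (μ.colLen j - (i + 1)) + 1

/-- `μ` is an `n`-core: no hook length of a cell of `μ` is a multiple of `n`. -/
def IsCore (n : ℕ) (μ : YoungDiagram) : Prop :=
  ∀ i j : ℕ, (i, j) ∈ μ → ¬ n ∣ hookLength μ i j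

/-- The set of all `(s, ms - 1, ms + 1)`-core partitions. -/
def cores (s m : ℕ) : Set YoungDiagram :=
  {μ | IsCore s μ ∧ IsCore (m * s - 1) μ ∧ IsCore (m * s + 1) μ}

/-- The `β`-set of a partition: the set of hook lengths of the cells of the first column. -/
def betaSet (μ : YoungDiagram) : Finset ℕ :=
  (Finset.range (μ.colLen 0)).image fun i => hookLength μ i 0

/-- The `N`-pyramid with base `[a, b]`: the positions `(i, j)`, in row `i` and column `j` of the
`N`-abacus, with `a + i ≤ j ≤ b - i`. The position `(i, j)` is identified with the number
`N * i + j` that stands there. -/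
def pyramid (N a b : ℕ) : Set ℕ :=
  {x | ∃ i j : ℕ, a + i ≤ j ∧ j + i ≤ b ∧ x = N * i + j}

/-- `𝓛_m(s)`: the union of the `ms`-pyramids with bases `[(k - 1)s + 1, ks - 1]` for
`1 ≤ k ≤ m - 1` and of the `ms`-pyramid with base `[(m - 1)s + 1, ms - 2]`. -/
def bigL (m s : ℕ) : Set ℕ :=
  (⋃ k ∈ Finset.Icc 1 (m - 1), pyramid (m * s) ((k - 1) * s + 1) (k * s - 1)) ∪
    pyramid (m * s) ((m - 1) * s + 1) (m * s - 2)

end CorePartition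

/-
The `β`-set of an `s`-core is an `s`-abacus in which every runner is filled from the top. The
differences `e i` between the heights of adjacent runners sum to `-1`, and being an
`(ms ± 1)`-core means that `|e i| ≤ m` for all `i`. Minus four times the size is the quadratic form
`E e = ∑ i j, e i * e j * d * (s - d)`, `d = |i - j|`, in which `E (δ_p - δ_q) < 0`. Hence at a
minimum of `E` all entries of `e` but one, at `z` say, are `±m`. If `Q` is the set of positions of
the entries `-m`, then `E e` is a constant plus a nonnegative combination of `E` at the indicator
functions of `Q` and `Q ∪ {z}`. Among sets of a given cardinality `E` is minimal at the intervals,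
by an identity in the gaps between the elements of the set, and the case of equality leaves
only two possibilities for `e`, which belong to a core and its conjugate.
-/

namespace CorePartition

theorem lt_rowLen_iff_lt_colLen (μ : YoungDiagram) (i j : ℕ) :
    j < μ.rowLen i ↔ i < μ.colLen j := by
  rw [← YoungDiagram.mem_iff_lt_rowLen, YoungDiagram.mem_iff_lt_colLen]

theorem hookLength_transpose (μ : YoungDiagram) (i j : ℕ) :
    hookLength μ.transpose i j = hookLength μ j i := by
  rw [hookLength, hookLength, YoungDiagram.rowLen_transpose, YoungDiagram.colLen_transpose,
    Nat.add_comm (_ - _)]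

theorem IsCore.transpose {n : ℕ} {μ : YoungDiagram} (h : IsCore n μ) : IsCore n μ.transpose := by
  intro i j hij
  rw [hookLength_transpose]
  exact h j i (YoungDiagram.mem_transpose.1 hij)

theorem transpose_mem_cores {s m : ℕ} {μ : YoungDiagram} (h : μ ∈ cores s m) :
    μ.transpose ∈ cores s m :=
  ⟨h.1.transpose, h.2.1.transpose, h.2.2.transpose⟩

theorem card_transpose (μ : YoungDiagram) : μ.transpose.card = μ.card := by
  simp [YoungDiagram.card, YoungDiagram.transpose]

theorem mem_betaSet {μ : YoungDiagram} {x : ℕ} :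
    x ∈ betaSet μ ↔ ∃ i < μ.colLen 0, x + (i + 1) = μ.rowLen i + μ.colLen 0 := by
  simp only [betaSet, Finset.mem_image, Finset.mem_range, hookLength]
  refine exists_congr fun i => and_congr_right fun hi => ?_
  have := (lt_rowLen_iff_lt_colLen μ i 0).2 hi
  omega

theorem zero_notMem_betaSet (μ : YoungDiagram) : 0 ∉ betaSet μ := by
  rw [mem_betaSet]
  rintro ⟨i, hi, h⟩
  have := (lt_rowLen_iff_lt_colLen μ i 0).2 hi
  omega

-- The boundary path of `μ` has one step for each natural number from `0` on: the vertical steps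
-- are the elements of the `β`-set, and the horizontal step below column `j` has the number
-- `μ.colLen 0 + j - μ.colLen j`.
theorem notMem_betaSet {μ : YoungDiagram} {x : ℕ} :
    x ∉ betaSet μ ↔ ∃ j, x + μ.colLen j = μ.colLen 0 + j := by
  constructor
  · intro hx
    have hex : ∃ j, x + μ.colLen j ≤ μ.colLen 0 + j :=
      ⟨x, by have := μ.colLen_anti 0 x (Nat.zero_le x); omega⟩
    classical
    have hfind := Nat.find_spec hex
    have hmin := fun j => Nat.find_min hex (m := j)
    generalize Nat.find hex = j at hfind hmin
    refine ⟨j, hfind.antisymm ?_⟩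
    by_contra! hlt
    obtain _ | j := j
    · omega
    have hj := hmin j (Nat.lt_succ_self j)
    obtain ⟨i, hi⟩ : ∃ i, x + (i + 1) = j + 1 + μ.colLen 0 :=
      ⟨j + μ.colLen 0 - x, by have := μ.colLen_anti 0 j (Nat.zero_le j); omega⟩
    have hrow := lt_rowLen_iff_lt_colLen μ i j
    have hrow' := lt_rowLen_iff_lt_colLen μ i (j + 1)
    have hcol := μ.colLen_anti 0 j (Nat.zero_le j)
    exact hx (mem_betaSet.2 ⟨i, by omega, by omega⟩)
  · rintro ⟨j, hj⟩ hx
    obtain ⟨i, _, hx⟩ := mem_betaSet.1 hx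
    have := lt_rowLen_iff_lt_colLen μ i j
    omega

theorem exists_hookLength_eq_iff {μ : YoungDiagram} {h : ℕ} (hh : 0 < h) :
    (∃ i j, (i, j) ∈ μ ∧ hookLength μ i j = h) ↔ ∃ y ∉ betaSet μ, y + h ∈ betaSet μ := by
  constructor
  · rintro ⟨i, j, hij, rfl⟩
    have hrow := YoungDiagram.mem_iff_lt_rowLen.1 hij
    have hcol := YoungDiagram.mem_iff_lt_colLen.1 hij
    have hcol' := μ.colLen_anti 0 j (Nat.zero_le j)
    refine ⟨μ.colLen 0 + j - μ.colLen j, notMem_betaSet.2 ⟨j, by omega⟩,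
      mem_betaSet.2 ⟨i, by omega, ?_⟩⟩
    rw [hookLength]
    omega
  · rintro ⟨y, hy, hyh⟩
    obtain ⟨j, hj⟩ := notMem_betaSet.1 hy
    obtain ⟨i, _, hi⟩ := mem_betaSet.1 hyh
    have hij := lt_rowLen_iff_lt_colLen μ i j
    refine ⟨i, j, YoungDiagram.mem_iff_lt_rowLen.2 (by omega), ?_⟩
    rw [hookLength]
    omega

theorem isCore_iff {n : ℕ} {μ : YoungDiagram} :
    IsCore n μ ↔ ∀ y, y + n ∈ betaSet μ → y ∈ betaSet μ := by
  constructor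
  · intro h y hyn
    by_contra hy
    rcases n.eq_zero_or_pos with rfl | hn
    · exact hy hyn
    obtain ⟨i, j, hij, hook⟩ := (exists_hookLength_eq_iff hn).2 ⟨y, hy, hyn⟩
    exact h i j hij hook.symm.dvd
  · rintro h i j hij ⟨c, hc⟩
    have hpos : 0 < hookLength μ i j := Nat.succ_pos _
    obtain ⟨y, hy, hyc⟩ := (exists_hookLength_eq_iff hpos).1 ⟨i, j, hij, rfl⟩
    rw [hc] at hyc
    have descend : ∀ c, y + n * c ∈ betaSet μ → y ∈ betaSet μ := by
      intro c
      induction c with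
      | zero => exact id
      | succ c ih => exact fun hc => ih (h _ (by rwa [Nat.mul_succ, ← add_assoc] at hc))
    exact hy (descend c hyc)

theorem strictMono_rowLen_rev_add (μ : YoungDiagram) :
    StrictMono fun k : Fin (μ.colLen 0) => μ.rowLen k.rev + k :=
  fun _ _ hab => add_lt_add_of_le_of_lt (μ.rowLen_anti _ _ (Fin.rev_le_rev.2 hab.le)) hab

theorem betaSet_eq_image (μ : YoungDiagram) :
    betaSet μ = Finset.univ.image fun k : Fin (μ.colLen 0) => μ.rowLen k.rev + k := by
  ext x
  rw [mem_betaSet, Finset.mem_image, Fin.rev_surjective.exists, Fin.exists_iff]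
  simp only [Finset.mem_univ, true_and, Fin.rev_rev, Fin.val_rev, exists_prop]
  refine exists_congr fun i => and_congr_right fun hi => ?_
  omega

theorem card_betaSet (μ : YoungDiagram) : (betaSet μ).card = μ.colLen 0 := by
  rw [betaSet_eq_image, Finset.card_image_of_injective _ (strictMono_rowLen_rev_add μ).injective,
    Finset.card_univ, Fintype.card_fin]

theorem card_eq_sum_rowLen (μ : YoungDiagram) :
    μ.card = ∑ i : Fin (μ.colLen 0), μ.rowLen i := by
  rw [Fin.sum_univ_eq_sum_range, YoungDiagram.card,
    Finset.card_eq_sum_card_fiberwise (f := Prod.fst) (t := Finset.range (μ.colLen 0))]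
  · exact Finset.sum_congr rfl fun i _ => (μ.rowLen_eq_card).symm
  · rintro ⟨i, j⟩ hij
    have h := YoungDiagram.mem_iff_lt_colLen.1 ((YoungDiagram.mem_cells _).1 hij)
    simpa using h.trans_le (μ.colLen_anti 0 j (Nat.zero_le j))

theorem two_mul_sum_betaSet (μ : YoungDiagram) :
    2 * ∑ x ∈ betaSet μ, x + (betaSet μ).card = 2 * μ.card + (betaSet μ).card ^ 2 := by
  have hsum : ∑ x ∈ betaSet μ, x = μ.card + ∑ k ∈ Finset.range (μ.colLen 0), k := by
    rw [betaSet_eq_image, Finset.sum_image (strictMono_rowLen_rev_add μ).injective.injOn,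
      Finset.sum_add_distrib, card_eq_sum_rowLen, ← Fin.sum_univ_eq_sum_range,
      ← Equiv.sum_comp Fin.revPerm fun i => μ.rowLen i]
    rfl
  rw [hsum, card_betaSet]
  cases μ.colLen 0 with
  | zero => simp
  | succ n =>
    have hgauss := Finset.sum_range_id_mul_two (n + 1)
    rw [Nat.add_sub_cancel] at hgauss
    linarith

theorem rowLen_rev_add {μ : YoungDiagram} {X : Finset ℕ} {n : ℕ} (hX : betaSet μ = X)
    (hn : X.card = n) (k : Fin n) : μ.rowLen k.rev + k = X.orderEmbOfFin hn k := by
  subst hX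
  obtain rfl : n = μ.colLen 0 := hn.symm.trans (card_betaSet μ)
  refine congrFun (Finset.orderEmbOfFin_unique hn (fun k => ?_) (strictMono_rowLen_rev_add μ)) k
  rw [betaSet_eq_image]
  exact Finset.mem_image_of_mem _ (Finset.mem_univ k)

theorem betaSet_injective : Function.Injective betaSet := by
  intro μ ν h
  have hcol : μ.colLen 0 = ν.colLen 0 := by rw [← card_betaSet, ← card_betaSet, h]
  have hrow (i : Fin (μ.colLen 0)) : μ.rowLen i = ν.rowLen i := by
    have := rowLen_rev_add h ((card_betaSet ν).trans hcol.symm) i.rev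
    rw [← rowLen_rev_add rfl ((card_betaSet ν).trans hcol.symm), Fin.rev_rev] at this
    exact Nat.add_right_cancel this
  ext ⟨i, j⟩
  simp only [YoungDiagram.mem_cells, YoungDiagram.mem_iff_lt_rowLen]
  rcases lt_or_ge i (μ.colLen 0) with hi | hi
  · rw [hrow ⟨i, hi⟩]
  · have hμ := lt_rowLen_iff_lt_colLen μ i 0
    have hν := lt_rowLen_iff_lt_colLen ν i 0
    omega

theorem add_le_add_of_strictMono {k : ℕ} {f : Fin k → ℕ} (hf : StrictMono f) {i j : Fin k}
    (hij : i ≤ j) : f i + j ≤ f j + i := by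
  obtain ⟨j, hj⟩ := j
  induction j with
  | zero => rw [le_antisymm hij (Nat.zero_le _)]
  | succ j ih =>
    rcases hij.lt_or_eq with h | rfl
    · have hle := ih (by omega) (Nat.lt_succ_iff.1 (Fin.lt_def.1 h))
      have hlt : f ⟨j, by omega⟩ < f ⟨j + 1, hj⟩ := hf (Nat.lt_succ_self j)
      dsimp only at hle ⊢
      omega
    · rfl

theorem exists_rowLen_eq {k : ℕ} {r : Fin k → ℕ} (hr : Antitone r) (hpos : ∀ i, 0 < r i) :
    ∃ μ : YoungDiagram, μ.colLen 0 = k ∧ ∀ i : Fin k, μ.rowLen i = r i := by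
  have hsorted : (List.ofFn r).SortedGE := by
    rw [List.sortedGE_ofFn_iff]
    exact hr
  refine ⟨YoungDiagram.ofRowLens _ hsorted, ?_, fun i => ?_⟩
  · rw [← YoungDiagram.length_rowLens, YoungDiagram.rowLens_length_ofRowLens, List.length_ofFn]
    exact List.forall_mem_ofFn_iff.2 hpos
  · simpa using YoungDiagram.rowLen_ofRowLens (hw := hsorted) ⟨i, by simp⟩

theorem exists_betaSet_eq {X : Finset ℕ} (hX : 0 ∉ X) : ∃ μ : YoungDiagram, betaSet μ = X := by
  set f := X.orderEmbOfFin rfl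
  have hlt (k : Fin X.card) : (k : ℕ) < f k := by
    have hk : 0 < X.card := k.pos
    have h0 : 0 < f ⟨0, hk⟩ :=
      Nat.pos_of_ne_zero fun h => hX (h ▸ X.orderEmbOfFin_mem rfl _)
    have := add_le_add_of_strictMono f.strictMono (i := ⟨0, hk⟩) (Nat.zero_le k)
    dsimp only at this
    omega
  obtain ⟨μ, hcol, hrow⟩ := exists_rowLen_eq (r := fun i => f i.rev - i.rev)
    (fun a b hab => by
      have := add_le_add_of_strictMono f.strictMono (Fin.rev_le_rev.2 hab)
      have := hlt b.rev
      dsimp only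
      omega)
    fun i => Nat.sub_pos_of_lt (hlt i.rev)
  refine ⟨μ, ?_⟩
  rw [betaSet_eq_image, ← X.image_orderEmbOfFin_univ rfl, hcol]
  congr 1
  funext k
  rw [hrow, Fin.rev_rev, Nat.sub_add_cancel (hlt k).le]

/-- The `β`-set of the `s`-abacus whose runner `r` (the numbers congruent to `r` modulo `s`)
carries `n r` beads, pushed up as far as possible. -/
def abacus (s : ℕ) (n : ℕ → ℕ) : Finset ℕ :=
  ((Finset.range s).sigma fun r => Finset.range (n r)).image fun p => s * p.2 + p.1

/-- The number of beads on runner `r`. At `r = s` the value is `-1`: runner `s` is runner `0`,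
which is empty, shifted up by one row. -/
def height (s : ℕ) (n : ℕ → ℕ) (r : ℕ) : ℤ := if r < s then n r else -1

/-- The differences between the heights of adjacent runners. -/
def steps (s : ℕ) (n : ℕ → ℕ) (i : Fin s) : ℤ := height s n (i + 1) - height s n i

section Abacus

variable {s : ℕ} {n : ℕ → ℕ}

theorem height_of_lt {r : ℕ} (hr : r < s) : height s n r = n r := if_pos hr

theorem height_self : height s n s = -1 := if_neg (lt_irrefl s)

theorem height_zero (hs : 0 < s) (h0 : n 0 = 0) : height s n 0 = 0 := by
  rw [height_of_lt hs, h0, Nat.cast_zero]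

theorem injOn_mul_add (s : ℕ) (n : ℕ → ℕ) : Set.InjOn (fun p : (_ : ℕ) × ℕ => s * p.2 + p.1)
    ((Finset.range s).sigma fun r => Finset.range (n r)) := by
  rintro ⟨r, k⟩ hk ⟨r', k'⟩ hk' h
  have hr : r < s := Finset.mem_range.1 (Finset.mem_sigma.1 hk).1
  have hr' : r' < s := Finset.mem_range.1 (Finset.mem_sigma.1 hk').1
  have hmod := congrArg (· % s) h
  have hdiv := congrArg (· / s) h
  simp only [Nat.mul_add_mod, Nat.mod_eq_of_lt, hr, hr', Nat.mul_add_div hr.pos,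
    Nat.div_eq_of_lt, add_zero] at hmod hdiv
  rw [hmod, hdiv]

theorem sum_abacus {M : Type*} [AddCommMonoid M] (g : ℕ → M) :
    ∑ x ∈ abacus s n, g x
      = ∑ r ∈ Finset.range s, ∑ k ∈ Finset.range (n r), g (s * k + r) := by
  rw [abacus, Finset.sum_image (injOn_mul_add s n), Finset.sum_sigma]

theorem card_abacus (s : ℕ) (n : ℕ → ℕ) : (abacus s n).card = ∑ r ∈ Finset.range s, n r := by
  rw [Finset.card_eq_sum_ones, sum_abacus]
  simp only [Finset.sum_const, Finset.card_range, smul_eq_mul, mul_one]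

theorem mul_add_mem_abacus {r k : ℕ} (hr : r < s) : s * k + r ∈ abacus s n ↔ k < n r := by
  simp only [abacus, Finset.mem_image, Finset.mem_sigma, Finset.mem_range, Sigma.exists]
  constructor
  · rintro ⟨r', k', ⟨hr', hk'⟩, h⟩
    have hmod := congrArg (· % s) h
    have hdiv := congrArg (· / s) h
    simp only [Nat.mul_add_mod, Nat.mod_eq_of_lt, hr, hr', Nat.mul_add_div hr.pos,
      Nat.div_eq_of_lt, add_zero] at hmod hdiv
    rwa [← hmod, ← hdiv]
  · exact fun hk => ⟨r, k, ⟨hr, hk⟩, rfl⟩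

theorem mul_add_mem_abacus_iff_lt_height (h0 : n 0 = 0) (hs : 0 < s) {r k : ℕ} (hr : r ≤ s) :
    s * k + r ∈ abacus s n ↔ (k : ℤ) < height s n r := by
  rcases hr.lt_or_eq with hr | rfl
  · rw [mul_add_mem_abacus hr, height_of_lt hr, Nat.cast_lt]
  · have hk := mul_add_mem_abacus (n := n) (k := k + 1) hs
    rw [mul_add, mul_one, add_zero, h0] at hk
    rw [hk, height_self]
    omega

theorem forall_mul_add (hs : 0 < s) {p : ℕ → Prop} :
    (∀ y, p y) ↔ ∀ i : Fin s, ∀ k, p (s * k + i) := by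
  refine ⟨fun h i k => h _, fun h y => ?_⟩
  have := h ⟨y % s, Nat.mod_lt y hs⟩ (y / s)
  rwa [Nat.div_add_mod] at this

theorem add_mem_abacus {y : ℕ} (hy : y + s ∈ abacus s n) : y ∈ abacus s n := by
  rcases s.eq_zero_or_pos with rfl | hs
  · exact hy
  revert y
  rw [forall_mul_add hs]
  intro i k hk
  rw [add_right_comm, ← Nat.mul_succ, mul_add_mem_abacus i.2] at hk
  exact (mul_add_mem_abacus i.2).2 (Nat.lt_of_succ_lt hk)

theorem exists_eq_abacus (hs : 0 < s) {X : Finset ℕ} (hX : ∀ y, y + s ∈ X → y ∈ X)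
    (hX0 : 0 ∉ X) : ∃ n, n 0 = 0 ∧ X = abacus s n := by
  have hfin (r : ℕ) : ∃ k, s * k + r ∉ X := by
    obtain ⟨b, hb⟩ := X.bddAbove
    refine ⟨b + 1, fun h => ?_⟩
    have := hb (Finset.mem_coe.2 h)
    nlinarith
  have hanti (r : ℕ) : Antitone fun k => s * k + r ∈ X :=
    antitone_nat_of_succ_le fun k hk => hX _ (by rwa [add_right_comm, ← Nat.mul_succ])
  classical
  refine ⟨fun r => Nat.find (hfin r), (Nat.find_eq_zero _).2 (by simpa using hX0), ?_⟩
  ext y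
  revert y
  rw [forall_mul_add hs]
  intro i k
  rw [mul_add_mem_abacus i.2, Nat.lt_find_iff]
  exact ⟨fun hk l hl => not_not.2 (hanti i hl hk), fun h => not_not.1 (h k le_rfl)⟩

theorem sum_steps (hs : 0 < s) (h0 : n 0 = 0) : ∑ i, steps s n i = -1 := by
  simp only [steps]
  rw [Fin.sum_univ_eq_sum_range (fun i => height s n (i + 1) - height s n i),
    Finset.sum_range_sub, height_zero hs h0, height_self, sub_zero]

theorem abacus_eq_of_steps_eq {n' : ℕ → ℕ} (h0 : n 0 = n' 0) (h : steps s n = steps s n') :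
    abacus s n = abacus s n' := by
  have hn : ∀ r < s, n r = n' r := by
    intro r
    induction r with
    | zero => exact fun _ => h0
    | succ r ih =>
      intro hr
      have hstep := congrFun h ⟨r, by omega⟩
      simp only [steps, height_of_lt hr, height_of_lt (Nat.lt_of_succ_lt hr)] at hstep
      have := ih (Nat.lt_of_succ_lt hr)
      omega
  ext y
  rcases s.eq_zero_or_pos with rfl | hs
  · simp [abacus]
  revert y
  rw [forall_mul_add hs]
  intro i k
  rw [mul_add_mem_abacus i.2, mul_add_mem_abacus i.2, hn i i.2]

theorem forall_lt_imp_lt_iff {a b : ℤ} (ha : 0 ≤ a) (m : ℕ) :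
    (∀ k : ℕ, ((k + m : ℕ) : ℤ) < b → (k : ℤ) < a) ↔ b - a ≤ m := by
  constructor
  · intro h
    have := h a.toNat
    omega
  · intro h k hk
    omega

theorem forall_add_mem_abacus_iff (hs : 0 < s) (h0 : n 0 = 0) (m : ℕ) :
    (∀ y, y + (m * s + 1) ∈ abacus s n → y ∈ abacus s n) ↔ ∀ i, steps s n i ≤ m := by
  rw [forall_mul_add hs]
  refine forall_congr' fun i => ?_
  rw [steps, ← forall_lt_imp_lt_iff (by rw [height_of_lt i.2]; positivity) m]
  refine forall_congr' fun k => ?_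
  rw [← mul_add_mem_abacus_iff_lt_height h0 hs i.2.le,
    ← mul_add_mem_abacus_iff_lt_height h0 hs i.2]
  rw [show s * k + i + (m * s + 1) = s * (k + m) + (i + 1) by ring]

-- For `y = s * k + (i + 1)` the condition compares runners `i` and `i + 1`; the remaining number
-- `y = 0` gives the condition that the virtual row `k = -1` would give for `i = s - 1`.
theorem forall_add_sub_one_mem_abacus_iff_height {m : ℕ} (hs : 0 < s) (hm : 0 < m)
    (h0 : n 0 = 0) :
    (∀ y, y + (m * s - 1) ∈ abacus s n → y ∈ abacus s n) ↔ height s n (s - 1) < m ∧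
      ∀ i : Fin s, ∀ k : ℕ, ((k + m : ℕ) : ℤ) < height s n i → (k : ℤ) < height s n (i + 1) := by
  have hms : 0 < m * s := Nat.mul_pos hm hs
  have hzero : 0 ∉ abacus s n := by
    simpa [h0] using mul_add_mem_abacus (n := n) (k := 0) hs
  have hshift (k : ℕ) (i : Fin s) : s * k + i + 1 + (m * s - 1) = s * (k + m) + i := by
    rw [mul_add, mul_comm s m]
    omega
  have hsucc : (∀ y, y + 1 + (m * s - 1) ∈ abacus s n → y + 1 ∈ abacus s n) ↔
      ∀ i : Fin s, ∀ k : ℕ, ((k + m : ℕ) : ℤ) < height s n i → (k : ℤ) < height s n (i + 1) := by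
    rw [forall_mul_add hs]
    refine forall₂_congr fun i k => ?_
    rw [hshift, mul_add_mem_abacus_iff_lt_height h0 hs i.2.le, add_assoc,
      mul_add_mem_abacus_iff_lt_height h0 hs i.2]
  have hlast : (0 + (m * s - 1) ∈ abacus s n → 0 ∈ abacus s n) ↔ height s n (s - 1) < m := by
    have hmul : 0 + (m * s - 1) = s * (m - 1) + (s - 1) := by
      obtain ⟨m, rfl⟩ := Nat.exists_eq_add_of_lt hm
      simp only [zero_add, Nat.add_sub_cancel, add_mul, one_mul, mul_comm s m]
      omega
    rw [hmul, mul_add_mem_abacus_iff_lt_height h0 hs (Nat.sub_le s 1), imp_iff_not hzero]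
    omega
  rw [← Nat.and_forall_add_one, hlast, hsucc]

theorem forall_add_sub_one_mem_abacus_iff {m : ℕ} (hs : 0 < s) (hm : 0 < m) (h0 : n 0 = 0) :
    (∀ y, y + (m * s - 1) ∈ abacus s n → y ∈ abacus s n) ↔ ∀ i, -m ≤ steps s n i := by
  rw [forall_add_sub_one_mem_abacus_iff_height hs hm h0]
  refine ⟨fun ⟨hfoot, hstep⟩ i => ?_, fun h => ⟨?_, fun i k hk => ?_⟩⟩
  · rcases (Nat.succ_le_of_lt i.2).lt_or_eq with hi | hi
    · have := (forall_lt_imp_lt_iff (by rw [height_of_lt hi]; positivity) m).1 (hstep i)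
      rw [steps]
      omega
    · rw [show s - 1 = i by omega] at hfoot
      rw [steps, ← Nat.succ_eq_add_one, hi, height_self]
      omega
  · have := h ⟨s - 1, by omega⟩
    simp only [steps, Nat.sub_add_cancel hs, height_self] at this
    omega
  · have := h i
    rw [steps] at this
    omega

theorem mem_cores_iff {m : ℕ} (hs : 0 < s) (hm : 0 < m) (h0 : n 0 = 0) {μ : YoungDiagram}
    (hμ : betaSet μ = abacus s n) : μ ∈ cores s m ↔ ∀ i, |steps s n i| ≤ m := by
  simp only [cores, Set.mem_ofPred_eq, isCore_iff, hμ, forall_add_mem_abacus_iff hs h0,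
    forall_add_sub_one_mem_abacus_iff hs hm h0, abs_le, forall_and]
  exact and_iff_right fun y => add_mem_abacus

theorem exists_betaSet_eq_abacus {m : ℕ} (hs : 0 < s) {μ : YoungDiagram} (hμ : μ ∈ cores s m) :
    ∃ n, n 0 = 0 ∧ betaSet μ = abacus s n :=
  exists_eq_abacus hs (isCore_iff.1 hμ.1) (zero_notMem_betaSet μ)

end Abacus

/-- The coefficients `d * (s - d)`, `d = |i - j|`, of the quadratic form that measures the size of
an `s`-core in terms of the steps of its abacus. -/
def kernel (s i j : ℕ) : ℤ := |(i : ℤ) - j| * (s - |(i : ℤ) - j|)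

/-- The bilinear form on `ℤ ^ s` with coefficients `kernel s i j`. -/
def form (s : ℕ) : LinearMap.BilinForm ℤ (Fin s → ℤ) :=
  Matrix.toBilin' (Matrix.of fun i j : Fin s => kernel s i j)

/-- The quadratic form of `form s`. On the steps of an `s`-core it is minus four times the size, see
`energy_steps`, so that the largest cores are those of least energy. -/
def energy (s : ℕ) (x : Fin s → ℤ) : ℤ := form s x x

theorem kernel_comm (s i j : ℕ) : kernel s i j = kernel s j i := by
  rw [kernel, kernel, abs_sub_comm]

theorem kernel_self (s i : ℕ) : kernel s i i = 0 := by simp [kernel]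

theorem form_apply {s : ℕ} (x y : Fin s → ℤ) :
    form s x y = ∑ i, ∑ j, x i * y j * kernel s i j := by
  simp only [form, Matrix.toBilin'_apply, Matrix.of_apply, mul_right_comm]

theorem isSymm_form (s : ℕ) : (form s).IsSymm := by
  rw [form, Matrix.isSymm_toBilin'_iff_isSymm]
  exact Matrix.IsSymm.ext fun i j => kernel_comm s j i

theorem form_single {s : ℕ} (i j : Fin s) :
    form s (Pi.single i 1) (Pi.single j 1) = kernel s i j := by
  rw [form, Matrix.toBilin'_single, Matrix.of_apply]

section Energy

variable {s : ℕ} {n : ℕ → ℕ} {μ : YoungDiagram}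

theorem sum_sum_mul_sq_sub {ι R : Type*} [CommRing R] (t : Finset ι) (a f : ι → R) :
    ∑ i ∈ t, ∑ j ∈ t, a i * a j * (f i - f j) ^ 2
      = 2 * (∑ i ∈ t, a i) * ∑ i ∈ t, f i ^ 2 * a i - 2 * (∑ i ∈ t, f i * a i) ^ 2 := by
  have hexpand (i j : ι) : a i * a j * (f i - f j) ^ 2
      = f i ^ 2 * a i * a j + a i * (f j ^ 2 * a j) - 2 * (f i * a i * (f j * a j)) := by ring
  simp only [hexpand, Finset.sum_add_distrib, Finset.sum_sub_distrib, ← Finset.mul_sum,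
    ← Finset.sum_mul]
  ring

section SummationByParts

variable {y : ℕ → ℤ} (h0 : y 0 = 0) (n : ℕ)
include h0

theorem sum_mul_sub : ∑ i ∈ Finset.range n, (i : ℤ) * (y (i + 1) - y i)
    = (n - 1) * y n - ∑ r ∈ Finset.range n, y r := by
  induction n with
  | zero => simp [h0]
  | succ n ih =>
    rw [Finset.sum_range_succ, ih, Finset.sum_range_succ]
    push_cast
    ring

theorem sum_sq_mul_sub : ∑ i ∈ Finset.range n, (i : ℤ) ^ 2 * (y (i + 1) - y i)
    = (n - 1) ^ 2 * y n - 2 * ∑ r ∈ Finset.range n, (r : ℤ) * y r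
      + ∑ r ∈ Finset.range n, y r := by
  induction n with
  | zero => simp [h0]
  | succ n ih =>
    simp only [Finset.sum_range_succ, ih]
    push_cast
    ring

theorem sum_sub_mul_abs_sub : ∑ i ∈ Finset.range n, (y (i + 1) - y i) * |(i : ℤ) - n|
    = ∑ r ∈ Finset.range (n + 1), y r := by
  have habs : ∀ i ∈ Finset.range n, (y (i + 1) - y i) * |(i : ℤ) - n|
      = n * (y (i + 1) - y i) - i * (y (i + 1) - y i) := fun i hi => by
    rw [abs_of_nonpos (by have := Finset.mem_range.1 hi; omega)]
    ring
  rw [Finset.sum_congr rfl habs, Finset.sum_sub_distrib, ← Finset.mul_sum, Finset.sum_range_sub,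
    sum_mul_sub h0, Finset.sum_range_succ, h0]
  ring

theorem sum_sum_sub_mul_abs_sub :
    ∑ i ∈ Finset.range n, ∑ j ∈ Finset.range n,
        (y (i + 1) - y i) * (y (j + 1) - y j) * |(i : ℤ) - j|
      = 2 * ∑ r ∈ Finset.range n, y r * (y n - y r) := by
  induction n with
  | zero => simp
  | succ n ih =>
    have hrow : ∑ i ∈ Finset.range n, (y (i + 1) - y i) * (y (n + 1) - y n) * |(i : ℤ) - n|
        = (y (n + 1) - y n) * ∑ r ∈ Finset.range (n + 1), y r := by
      rw [← sum_sub_mul_abs_sub h0, Finset.mul_sum]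
      exact Finset.sum_congr rfl fun i _ => by ring
    have hcol : ∑ j ∈ Finset.range n, (y (n + 1) - y n) * (y (j + 1) - y j) * |(n : ℤ) - j|
        = (y (n + 1) - y n) * ∑ r ∈ Finset.range (n + 1), y r := by
      rw [← hrow]
      exact Finset.sum_congr rfl fun j _ => by rw [abs_sub_comm]; ring
    have hshift : ∑ r ∈ Finset.range n, y r * (y (n + 1) - y r)
        = ∑ r ∈ Finset.range n, y r * (y n - y r)
          + (y (n + 1) - y n) * ∑ r ∈ Finset.range n, y r := by
      rw [Finset.mul_sum, ← Finset.sum_add_distrib]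
      exact Finset.sum_congr rfl fun r _ => by ring
    simp only [Finset.sum_range_succ _ n, Finset.sum_add_distrib] at hrow hcol ⊢
    rw [ih, hrow, hcol, hshift, sub_self, abs_zero]
    ring

theorem energy_sub (hn : y n = -1) : energy n (fun i => y (i + 1) - y i)
    = -(2 * n * ∑ r ∈ Finset.range n, y r ^ 2 + 4 * ∑ r ∈ Finset.range n, (r : ℤ) * y r
      - 2 * (∑ r ∈ Finset.range n, y r) ^ 2 - (2 * n - 2) * ∑ r ∈ Finset.range n, y r) := by
  have hsplit : energy n (fun i => y (i + 1) - y i)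
      = n * ∑ i ∈ Finset.range n, ∑ j ∈ Finset.range n,
          (y (i + 1) - y i) * (y (j + 1) - y j) * |(i : ℤ) - j|
        - ∑ i ∈ Finset.range n, ∑ j ∈ Finset.range n,
          (y (i + 1) - y i) * (y (j + 1) - y j) * ((i : ℤ) - j) ^ 2 := by
    simp only [energy, form_apply, Finset.mul_sum, ← Finset.sum_sub_distrib, Finset.sum_range]
    refine Finset.sum_congr rfl fun i _ => Finset.sum_congr rfl fun j _ => ?_
    rw [kernel, ← sq_abs ((i : ℤ) - j)]
    ring
  have hquad : ∑ r ∈ Finset.range n, y r * (-1 - y r)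
      = -∑ r ∈ Finset.range n, y r - ∑ r ∈ Finset.range n, y r ^ 2 := by
    rw [← Finset.sum_neg_distrib, ← Finset.sum_sub_distrib]
    exact Finset.sum_congr rfl fun r _ => by ring
  rw [hsplit, sum_sum_sub_mul_abs_sub h0, sum_sum_mul_sq_sub, Finset.sum_range_sub,
    sum_mul_sub h0, sum_sq_mul_sub h0, h0, hn, hquad]
  ring

end SummationByParts

theorem four_mul_card (hμ : betaSet μ = abacus s n) :
    4 * (μ.card : ℤ) = 2 * s * ∑ r ∈ Finset.range s, (n r : ℤ) ^ 2
      + 4 * ∑ r ∈ Finset.range s, (r : ℤ) * n r - 2 * (∑ r ∈ Finset.range s, (n r : ℤ)) ^ 2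
      - (2 * s - 2) * ∑ r ∈ Finset.range s, (n r : ℤ) := by
  have hcard : ((betaSet μ).card : ℤ) = ∑ r ∈ Finset.range s, (n r : ℤ) := by
    rw [hμ, card_abacus, Nat.cast_sum]
  have hrunner (r k : ℕ) : 2 * ∑ j ∈ Finset.range k, ((s * j + r : ℕ) : ℤ)
      = s * (k : ℤ) ^ 2 - s * k + 2 * (r * k) := by
    induction k with
    | zero => simp
    | succ k ih =>
      rw [Finset.sum_range_succ, mul_add, ih]
      push_cast
      ring
  have hsum : 2 * ∑ x ∈ betaSet μ, (x : ℤ) = s * ∑ r ∈ Finset.range s, (n r : ℤ) ^ 2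
      - s * ∑ r ∈ Finset.range s, (n r : ℤ) + 2 * ∑ r ∈ Finset.range s, (r : ℤ) * n r := by
    rw [hμ, sum_abacus, Finset.mul_sum]
    simp only [hrunner, Finset.sum_add_distrib, Finset.sum_sub_distrib, ← Finset.mul_sum]
  have hsize := congrArg (Nat.cast : ℕ → ℤ) (two_mul_sum_betaSet μ)
  push_cast at hsize
  rw [hsum, hcard] at hsize
  linear_combination -2 * hsize

theorem energy_steps (hs : 0 < s) (h0 : n 0 = 0) (hμ : betaSet μ = abacus s n) :
    energy s (steps s n) = -(4 * μ.card) := by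
  have hsum (g : ℕ → ℤ → ℤ) :
      ∑ r ∈ Finset.range s, g r (height s n r) = ∑ r ∈ Finset.range s, g r (n r) :=
    Finset.sum_congr rfl fun r hr => by rw [height_of_lt (Finset.mem_range.1 hr)]
  rw [four_mul_card hμ, ← hsum fun _ h => h ^ 2, ← hsum fun r h => r * h, ← hsum fun _ h => h]
  exact energy_sub (height_zero hs h0) s height_self

end Energy

theorem six_mul_sum_sub_mul_add (n : ℕ) (a b : ℤ) :
    6 * ∑ j ∈ Finset.range n, (a - j) * (b + j)
      = 6 * a * b * n + 3 * (a - b) * n * (n - 1) - n * (n - 1) * (2 * n - 1) := by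
  induction n with
  | zero => simp
  | succ n ih =>
    rw [Finset.sum_range_succ, mul_add, ih]
    push_cast
    ring

theorem kernel_of_le {s i j : ℕ} (h : j ≤ i) : kernel s i j = ((i : ℤ) - j) * (s - i + j) := by
  rw [kernel, abs_of_nonneg (by omega)]
  ring

theorem six_mul_sum_kernel {s i : ℕ} (hi : i < s) :
    6 * ∑ j ∈ Finset.range s, kernel s i j = (s : ℤ) ^ 3 - s := by
  obtain ⟨q, rfl⟩ := Nat.exists_eq_add_of_lt hi
  have hleft : ∑ j ∈ Finset.range i, kernel (i + q + 1) i j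
      = ∑ j ∈ Finset.range i, ((i : ℤ) - j) * (q + 1 + j) := by
    refine Finset.sum_congr rfl fun j hj => ?_
    rw [kernel_of_le (Finset.mem_range.1 hj).le]
    push_cast
    ring
  have hright : ∑ j ∈ Finset.range (q + 1), kernel (i + q + 1) i (i + j)
      = ∑ j ∈ Finset.range (q + 1), ((i + q + 1 : ℤ) - j) * (0 + j) := by
    refine Finset.sum_congr rfl fun j _ => ?_
    rw [kernel_comm, kernel_of_le (Nat.le_add_right i j)]
    push_cast
    ring
  rw [add_assoc, Finset.sum_range_add, ← add_assoc, hleft, hright, mul_add,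
    six_mul_sum_sub_mul_add, six_mul_sum_sub_mul_add]
  push_cast
  ring

/-- The sum of any row of the kernel. -/
def rowSum (s : ℕ) : ℤ := ∑ j ∈ Finset.range s, kernel s 0 j

theorem six_mul_rowSum (s : ℕ) : 6 * rowSum s = (s : ℤ) ^ 3 - s := by
  rcases s.eq_zero_or_pos with rfl | hs
  · simp [rowSum]
  · exact six_mul_sum_kernel hs

theorem sum_kernel {s : ℕ} (i : Fin s) : ∑ j : Fin s, kernel s i j = rowSum s := by
  have h := (six_mul_sum_kernel i.2).trans (six_mul_rowSum s).symm
  rw [Fin.sum_univ_eq_sum_range (kernel s i)]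
  omega

/-- The energy of (the indicator function of) an interval with `k` elements. -/
def arcEnergy (s k : ℕ) : ℤ := ∑ i ∈ Finset.range k, ∑ j ∈ Finset.range k, kernel s i j

theorem six_mul_arcEnergy (s k : ℕ) :
    6 * arcEnergy s k = 2 * s * ((k : ℤ) ^ 3 - k) - (k : ℤ) ^ 2 * ((k : ℤ) ^ 2 - 1) := by
  induction k with
  | zero => simp [arcEnergy]
  | succ k ih =>
    have hrow : ∑ j ∈ Finset.range k, kernel s k j
        = ∑ j ∈ Finset.range k, ((k : ℤ) - j) * (s - k + j) :=
      Finset.sum_congr rfl fun j hj => kernel_of_le (Finset.mem_range.1 hj).le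
    have hcol : ∑ i ∈ Finset.range k, kernel s i k = ∑ j ∈ Finset.range k, kernel s k j :=
      Finset.sum_congr rfl fun i _ => kernel_comm s i k
    have hsum := six_mul_sum_sub_mul_add k k (s - k)
    rw [arcEnergy] at ih
    simp only [arcEnergy, Finset.sum_range_succ, Finset.sum_add_distrib, hcol, hrow, kernel_self]
    push_cast
    linear_combination ih + 2 * hsum

section Gaps

variable {k : ℕ}

theorem sum_sum_sub_mul_eq_zero {ι R : Type*} [Fintype ι] [CommRing R] {w : ι → ι → R}
    (hw : ∀ i j, w i j = -w j i) (hrow : ∀ i, ∑ j, w i j = 0) (g : ι → R) :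
    ∑ i, ∑ j, (g i - g j) * w i j = 0 := by
  have hcol (j : ι) : ∑ i, w i j = 0 := by
    simp only [hw _ j, Finset.sum_neg_distrib, hrow, neg_zero]
  simp only [sub_mul, Finset.sum_sub_distrib]
  rw [Finset.sum_comm (f := fun i j => g j * w i j)]
  simp only [← Finset.mul_sum, hrow, hcol, mul_zero, Finset.sum_const_zero, sub_zero]

theorem sum_sign_sub {i : ℕ} (hi : i < k) :
    ∑ j ∈ Finset.range k, Int.sign ((i : ℤ) - j) = 2 * i - k + 1 := by
  obtain ⟨q, rfl⟩ := Nat.exists_eq_add_of_lt hi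
  have hleft : ∀ j ∈ Finset.range i, Int.sign ((i : ℤ) - j) = 1 := fun j hj =>
    Int.sign_eq_one_of_pos (sub_pos.2 (Nat.cast_lt.2 (Finset.mem_range.1 hj)))
  have hright : ∀ j ∈ Finset.range q, Int.sign ((i : ℤ) - (i + 1 + j : ℕ)) = -1 := fun j _ =>
    Int.sign_eq_neg_one_of_neg (by omega)
  rw [add_right_comm, Finset.sum_range_add, Finset.sum_range_succ, Finset.sum_congr rfl hleft,
    Finset.sum_congr rfl hright, sub_self, Int.sign_zero]
  simp only [Finset.sum_const, Finset.card_range, nsmul_eq_mul]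
  push_cast
  ring

theorem two_mul_sum_sub (a : ℤ) (n : ℕ) :
    2 * ∑ j ∈ Finset.range n, (a - j) = n * (2 * a - n + 1) := by
  induction n with
  | zero => simp
  | succ n ih =>
    rw [Finset.sum_range_succ, mul_add, ih]
    push_cast
    ring

/-- Since `|g i - g j| = (g i - g j) * sign (i - j)`, the left hand side is the sum of
`(g i - g j) * w i j` with the antisymmetric weights `w i j = k * sign (i - j) - 2 * (i - j)`, whose
rows sum to zero. -/
theorem sum_abs_sub_mul_eq_zero {g : Fin k → ℤ} (hg : Monotone g) :
    ∑ i, ∑ j, |g i - g j| * ((k : ℤ) - 2 * |(i : ℤ) - (j : ℕ)|) = 0 := by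
  have habs (i j : Fin k) : |g i - g j| * ((k : ℤ) - 2 * |(i : ℤ) - (j : ℕ)|)
      = (g i - g j) * (k * Int.sign ((i : ℤ) - (j : ℕ)) - 2 * ((i : ℤ) - (j : ℕ))) := by
    rcases lt_trichotomy i j with h | rfl | h
    · have := Fin.lt_def.1 h
      rw [abs_of_nonpos (sub_nonpos.2 (hg h.le)), abs_of_neg (by omega),
        Int.sign_eq_neg_one_of_neg (by omega)]
      ring
    · simp
    · have := Fin.lt_def.1 h
      rw [abs_of_nonneg (sub_nonneg.2 (hg h.le)), abs_of_pos (by omega),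
        Int.sign_eq_one_of_pos (by omega)]
      ring
  simp only [habs]
  refine sum_sum_sub_mul_eq_zero (fun i j => ?_) (fun i => ?_) g
  · rw [← neg_sub ((j : ℕ) : ℤ), Int.sign_neg]
    ring
  · rw [Fin.sum_univ_eq_sum_range
      fun j : ℕ => (k : ℤ) * Int.sign ((i : ℤ) - j) - 2 * ((i : ℤ) - j),
      Finset.sum_sub_distrib, ← Finset.mul_sum, ← Finset.mul_sum, sum_sign_sub i.2, two_mul_sum_sub,
      sub_self]

/-- For a strictly increasing sequence `q`, the number of missing values below `q i`. -/
def gap (q : Fin k → ℕ) (i : Fin k) : ℤ := q i - (i : ℕ)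

variable {q : Fin k → ℕ} {s : ℕ}

theorem monotone_gap (hq : StrictMono q) : Monotone (gap q) := by
  intro i j hij
  have := add_le_add_of_strictMono hq hij
  simp only [gap]
  omega

theorem gap_nonneg (hq : StrictMono q) (i : Fin k) : 0 ≤ gap q i := by
  have := monotone_gap hq (show ⟨0, i.pos⟩ ≤ i from Nat.zero_le _)
  simp only [gap] at this ⊢
  omega

theorem gap_le (hq : StrictMono q) (hqs : ∀ i, q i < s) (i : Fin k) : gap q i ≤ s - k := by
  have := monotone_gap hq (show i ≤ ⟨k - 1, Nat.sub_one_lt_of_lt i.2⟩ from Nat.le_sub_one_of_lt i.2)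
  have := hqs ⟨k - 1, Nat.sub_one_lt_of_lt i.2⟩
  simp only [gap] at *
  omega

theorem gap_term_nonneg (hq : StrictMono q) (hqs : ∀ i, q i < s) (i j : Fin k) :
    0 ≤ |gap q i - gap q j| * ((s : ℤ) - k - |gap q i - gap q j|) := by
  refine mul_nonneg (abs_nonneg _) (sub_nonneg.2 (abs_sub_le_of_nonneg_of_le ?_ ?_ ?_ ?_))
  exacts [gap_nonneg hq i, gap_le hq hqs i, gap_nonneg hq j, gap_le hq hqs j]

theorem sum_kernel_eq_arcEnergy_add (hq : StrictMono q) :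
    ∑ i, ∑ j, kernel s (q i) (q j) = arcEnergy s k
      + ∑ i, ∑ j, |gap q i - gap q j| * ((s : ℤ) - k - |gap q i - gap q j|) := by
  have habs (i j : Fin k) : |(q i : ℤ) - q j| = |(i : ℤ) - (j : ℕ)| + |gap q i - gap q j| := by
    rw [show (q i : ℤ) - q j = (i - (j : ℕ)) + (gap q i - gap q j) by simp only [gap]; ring,
      abs_add_eq_add_abs_iff]
    rcases le_total i j with h | h
    · exact Or.inr ⟨sub_nonpos.2 (Nat.cast_le.2 h), sub_nonpos.2 (monotone_gap hq h)⟩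
    · exact Or.inl ⟨sub_nonneg.2 (Nat.cast_le.2 h), sub_nonneg.2 (monotone_gap hq h)⟩
  have hkernel (i j : Fin k) : kernel s (q i) (q j) = kernel s i j
      + |gap q i - gap q j| * ((s : ℤ) - k - |gap q i - gap q j|)
      + |gap q i - gap q j| * ((k : ℤ) - 2 * |(i : ℤ) - (j : ℕ)|) := by
    rw [kernel, habs, kernel]
    ring
  simp only [hkernel, Finset.sum_add_distrib, sum_abs_sub_mul_eq_zero (monotone_gap hq), add_zero,
    arcEnergy, Finset.sum_range]

theorem arcEnergy_le_sum_kernel (hq : StrictMono q) (hqs : ∀ i, q i < s) :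
    arcEnergy s k ≤ ∑ i, ∑ j, kernel s (q i) (q j) := by
  rw [sum_kernel_eq_arcEnergy_add hq]
  exact le_add_of_nonneg_right
    (Finset.sum_nonneg fun i _ => Finset.sum_nonneg fun j _ => gap_term_nonneg hq hqs i j)

theorem gap_eq_or_abs_gap_sub_eq (hq : StrictMono q) (hqs : ∀ i, q i < s)
    (h : ∑ i, ∑ j, kernel s (q i) (q j) = arcEnergy s k) (i j : Fin k) :
    gap q i = gap q j ∨ |gap q i - gap q j| = s - k := by
  rw [sum_kernel_eq_arcEnergy_add hq, add_eq_left] at h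
  have hterm := gap_term_nonneg hq hqs
  have hi := (Finset.sum_eq_zero_iff_of_nonneg
    fun i _ => Finset.sum_nonneg fun j _ => hterm i j).1 h i (Finset.mem_univ i)
  have hij := (Finset.sum_eq_zero_iff_of_nonneg fun j _ => hterm i j).1 hi j (Finset.mem_univ j)
  rcases mul_eq_zero.1 hij with h0 | h0
  · exact Or.inl (sub_eq_zero.1 (abs_eq_zero.1 h0))
  · exact Or.inr (sub_eq_zero.1 h0).symm

theorem gap_eq_sub (hq : StrictMono q) (hqs : ∀ i, q i < s)
    (h : ∑ i, ∑ j, kernel s (q i) (q j) = arcEnergy s k) (hq0 : ∀ i, q i ≠ 0) {l : Fin k}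
    (hl : q l + 1 = s) (i : Fin k) : gap q i = s - k := by
  have hle := gap_le hq hqs
  have hlast : gap q l = s - k := by
    have := hle l
    simp only [gap] at *
    omega
  have hpos : 0 < gap q i := by
    have := hq0 ⟨0, i.pos⟩
    have := monotone_gap hq (show ⟨0, i.pos⟩ ≤ i from Nat.zero_le _)
    simp only [gap] at *
    omega
  rcases gap_eq_or_abs_gap_sub_eq hq hqs h i l with hil | hil
  · rw [hil, hlast]
  · rw [hlast, abs_of_nonpos (sub_nonpos.2 (hle i))] at hil
    omega

end Gaps

section Indicator

variable {s : ℕ}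

/-- The indicator function of a set of positions. -/
def ind (Q : Finset (Fin s)) : Fin s → ℤ := ∑ i ∈ Q, Pi.single i 1

theorem ind_apply (Q : Finset (Fin s)) (i : Fin s) : ind Q i = if i ∈ Q then 1 else 0 := by
  simp [ind, Finset.sum_apply, Pi.single_apply]

theorem sum_ind (Q : Finset (Fin s)) : ∑ i, ind Q i = Q.card := by
  simp [ind_apply]

theorem energy_ind (Q : Finset (Fin s)) :
    energy s (ind Q) = ∑ i ∈ Q, ∑ j ∈ Q, kernel s i j := by
  simp only [energy, ind, LinearMap.BilinForm.sum_left, LinearMap.BilinForm.sum_right, form_single]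
  exact Finset.sum_comm

theorem energy_ind_eq_sum_orderEmbOfFin (Q : Finset (Fin s)) :
    energy s (ind Q) = ∑ i, ∑ j, kernel s (Q.orderEmbOfFin rfl i) (Q.orderEmbOfFin rfl j) := by
  have hsum (f : Fin s → ℤ) : ∑ x ∈ Q, f x = ∑ i, f (Q.orderEmbOfFin rfl i) := by
    rw [← Finset.sum_coe_sort, ← (Q.orderIsoOfFin rfl).toEquiv.sum_comp]
    rfl
  simp only [energy_ind, hsum]

theorem arcEnergy_le_energy_ind (Q : Finset (Fin s)) : arcEnergy s Q.card ≤ energy s (ind Q) := by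
  rw [energy_ind_eq_sum_orderEmbOfFin]
  exact arcEnergy_le_sum_kernel (Q.orderEmbOfFin rfl).strictMono fun i => Fin.is_lt _

theorem energy_ind_final {k : ℕ} (hk : k ≤ s) :
    energy s (ind {i : Fin s | s ≤ i + k}) = arcEnergy s k := by
  obtain ⟨a, rfl⟩ := Nat.exists_eq_add_of_le' hk
  have hlt (i : Fin a) : ¬ a ≤ (i : ℕ) := i.2.not_ge
  simp only [energy_ind, Finset.sum_filter, Fin.sum_univ_add, arcEnergy, Finset.sum_range]
  simp [kernel, hlt]

theorem eq_final_of_energy_ind_eq {Q : Finset (Fin s)} {a b : Fin s} (ha : (a : ℕ) = 0)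
    (hb : (b : ℕ) + 1 = s) (h : energy s (ind Q) = arcEnergy s Q.card) (haQ : a ∉ Q) (hbQ : b ∈ Q) :
    Q = ({i | s ≤ i + Q.card} : Finset (Fin s)) := by
  set q : Fin Q.card → ℕ := fun i => Q.orderEmbOfFin rfl i
  have hmem (x : Fin s) (hx : x ∈ Q) : ∃ i, q i = x := by
    obtain ⟨i, hi⟩ := (Finset.range_orderEmbOfFin Q rfl).symm ▸ Finset.mem_coe.2 hx
    exact ⟨i, congrArg Fin.val hi⟩
  have hq0 (i : Fin Q.card) : q i ≠ 0 := fun hi =>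
    haQ (Fin.ext (hi.trans ha.symm) ▸ Q.orderEmbOfFin_mem rfl i)
  obtain ⟨l, hl⟩ := hmem b hbQ
  have hgap (i : Fin Q.card) : (q i : ℤ) - (i : ℕ) = s - Q.card := by
    rw [energy_ind_eq_sum_orderEmbOfFin] at h
    exact gap_eq_sub (Q.orderEmbOfFin rfl).strictMono (fun i => Fin.is_lt _) h hq0
      (show q l + 1 = s by omega) i
  ext x
  simp only [Finset.mem_filter_univ]
  constructor
  · intro hx
    obtain ⟨i, hi⟩ := hmem x hx
    have := hgap i
    omega
  · intro hx
    obtain ⟨i, hi⟩ : ∃ i : Fin Q.card, (i : ℕ) + s = x + Q.card :=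
      ⟨⟨x + Q.card - s, by omega⟩, Nat.sub_add_cancel hx⟩
    have hqx : q i = x := by
      have := hgap i
      omega
    exact Fin.ext hqx ▸ Q.orderEmbOfFin_mem rfl i

end Indicator

section Box

variable {ι : Type*} [Fintype ι] {m b : ℤ}

/-- The integer vectors with entries in `[-m, m]` and sum `b`. By `mem_cores_iff` and `sum_steps`
the steps of the `(s, ms - 1, ms + 1)`-cores are those of `boxSlice (Fin s) m (-1)`. -/
def boxSlice (ι : Type*) [Fintype ι] (m b : ℤ) : Set (ι → ℤ) :=
  {e | (∀ i, |e i| ≤ m) ∧ ∑ i, e i = b}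

theorem finite_boxSlice : (boxSlice ι m b).Finite := by
  classical
  exact (Set.finite_Icc (fun _ : ι => -m) fun _ => m).subset fun e he =>
    ⟨fun i => (abs_le.1 (he.1 i)).1, fun i => (abs_le.1 (he.1 i)).2⟩

theorem apply_add_add_apply_sub {R M : Type*} [CommRing R] [AddCommGroup M] [Module R M]
    (B : LinearMap.BilinForm R M) (x v : M) :
    B (x + v) (x + v) + B (x - v) (x - v) = 2 * (B x x + B v v) := by
  simp only [map_add, map_sub, LinearMap.add_apply, LinearMap.sub_apply]
  ring

variable [DecidableEq ι] {e : ι → ℤ} {p q : ι}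

theorem add_single_sub_single_mem_boxSlice (he : e ∈ boxSlice ι m b) (hpq : p ≠ q)
    (hp : e p < m) (hq : -m < e q) :
    e + (Pi.single p 1 - Pi.single q 1) ∈ boxSlice ι m b := by
  refine ⟨fun i => ?_, ?_⟩
  · have hi := abs_le.1 (he.1 i)
    rw [abs_le, Pi.add_apply, Pi.sub_apply]
    rcases eq_or_ne i p with rfl | hip
    · rw [Pi.single_eq_same, Pi.single_eq_of_ne hpq]
      omega
    · rcases eq_or_ne i q with rfl | hiq
      · rw [Pi.single_eq_same, Pi.single_eq_of_ne hip]
        omega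
      · rw [Pi.single_eq_of_ne hip, Pi.single_eq_of_ne hiq]
        omega
  · simp only [Pi.add_apply, Pi.sub_apply, Finset.sum_add_distrib, Finset.sum_sub_distrib,
      Finset.sum_pi_single', Finset.mem_univ, if_true, sub_self, add_zero, he.2]

/-- A form that is negative in the direction `v = δ_p - δ_q` is strictly concave along it, so one of
`e ± v` has less energy than `e` unless one of them leaves the box. -/
theorem abs_eq_or_abs_eq_of_isMinOn {B : LinearMap.BilinForm ℤ (ι → ℤ)}
    (he : e ∈ boxSlice ι m b) (hmin : IsMinOn (fun x => B x x) (boxSlice ι m b) e) (hpq : p ≠ q)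
    (hB : B (Pi.single p 1 - Pi.single q 1) (Pi.single p 1 - Pi.single q 1) < 0) :
    |e p| = m ∨ |e q| = m := by
  by_contra! hne
  have hp := abs_lt.1 ((he.1 p).lt_of_ne hne.1)
  have hq := abs_lt.1 ((he.1 q).lt_of_ne hne.2)
  have hadd := hmin (add_single_sub_single_mem_boxSlice he hpq hp.2 hq.1)
  have hsub := hmin (add_single_sub_single_mem_boxSlice he hpq.symm hq.2 hp.1)
  rw [← neg_sub (Pi.single p 1), ← sub_eq_add_neg] at hsub
  have := apply_add_add_apply_sub B e (Pi.single p 1 - Pi.single q 1)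
  simp only [Set.mem_ofPred_eq] at hadd hsub
  omega

end Box

section Spike

variable {s : ℕ}

theorem energy_single_sub_single {p q : Fin s} (hpq : p ≠ q) :
    energy s (Pi.single p 1 - Pi.single q 1) < 0 := by
  have hpos : 0 < kernel s p q := by
    have := Fin.val_ne_of_ne hpq
    rcases abs_cases ((p : ℤ) - (q : ℕ)) with h | h <;>
    exact mul_pos (abs_pos.2 (by omega)) (by omega)
  simp only [energy, map_sub, LinearMap.sub_apply, form_single, kernel_self, kernel_comm s q p]
  omega

theorem form_one_left (x : Fin s → ℤ) : form s 1 x = rowSum s * ∑ i, x i := by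
  simp only [form_apply, Pi.one_apply, one_mul]
  rw [Finset.sum_comm, Finset.mul_sum]
  refine Finset.sum_congr rfl fun j _ => ?_
  simp only [← Finset.mul_sum, kernel_comm s _ j, sum_kernel, mul_comm]

theorem energy_smul_one_sub (m : ℤ) (x : Fin s → ℤ) :
    energy s (m • 1 - x) = m * rowSum s * (m * s - 2 * ∑ i, x i) + energy s x := by
  have hx : form s x 1 = form s 1 x := (isSymm_form s).eq x 1
  simp only [energy, map_sub, map_smul, LinearMap.sub_apply, LinearMap.smul_apply, smul_eq_mul, hx,
    form_one_left, Pi.one_apply, Finset.sum_const, Finset.card_univ, Fintype.card_fin, nsmul_eq_mul]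
  ring

theorem energy_smul_add_smul (a b : ℤ) (x y : Fin s → ℤ) :
    energy s (a • x + b • y)
      = (a + b) * (a * energy s x + b * energy s y) - a * b * energy s (x - y) := by
  simp only [energy, map_add, map_sub, map_smul, LinearMap.add_apply, LinearMap.sub_apply,
    LinearMap.smul_apply, smul_eq_mul]
  ring

/-- The vector with the entry `c` at `z`, entries `-m` on `Q`, and entries `m` elsewhere. -/
def spike (m c : ℤ) (z : Fin s) (Q : Finset (Fin s)) (i : Fin s) : ℤ :=
  if i = z then c else if i ∈ Q then -m else m

variable {m c : ℤ} {z : Fin s} {Q : Finset (Fin s)}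

theorem spike_eq (hz : z ∉ Q) :
    spike m c z Q = m • 1 - ((m + c) • ind Q + (m - c) • ind (insert z Q)) := by
  ext i
  simp only [spike, Pi.sub_apply, Pi.add_apply, Pi.smul_apply, Pi.one_apply, smul_eq_mul, ind_apply,
    Finset.mem_insert]
  rcases eq_or_ne i z with rfl | hiz
  · rw [if_pos rfl, if_neg hz, if_pos (Or.inl rfl)]
    ring
  · simp only [hiz, if_false, false_or]
    split_ifs <;> ring

theorem sum_spike (hz : z ∉ Q) : ∑ i, spike m c z Q i = m * (s - 1 - 2 * Q.card) + c := by
  simp only [spike_eq hz, Pi.sub_apply, Pi.add_apply, Pi.smul_apply, Pi.one_apply, smul_eq_mul,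
    Finset.sum_sub_distrib, Finset.sum_add_distrib, ← Finset.mul_sum, sum_ind,
    Finset.card_insert_of_notMem hz, Finset.sum_const, Finset.card_univ, Fintype.card_fin,
    nsmul_eq_mul]
  push_cast
  ring

theorem energy_spike (hz : z ∉ Q) (hsum : ∑ i, spike m c z Q i = -1) :
    energy s (spike m c z Q) = -(m * (m * s + 2) * rowSum s)
      + (2 * m * (m + c) * energy s (ind Q) + 2 * m * (m - c) * energy s (ind (insert z Q))) := by
  have hsub : energy s (ind Q - ind (insert z Q)) = 0 := by
    rw [ind, ind, Finset.sum_insert hz, sub_add_cancel_right]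
    simp only [energy, map_neg, LinearMap.neg_apply, neg_neg, form_single, kernel_self]
  rw [sum_spike hz] at hsum
  rw [spike_eq hz, energy_smul_one_sub, energy_smul_add_smul, hsub]
  simp only [Pi.add_apply, Pi.smul_apply, smul_eq_mul, Finset.sum_add_distrib, ← Finset.mul_sum,
    sum_ind, Finset.card_insert_of_notMem hz]
  push_cast
  linear_combination (2 * m * rowSum s) * hsum

end Spike

section Minimum

variable {s m : ℕ}

/-- The one entry of a vector of least energy in `boxSlice (Fin s) m (-1)` that need not be `±m`:
it is `m - 1` for even `s` and `-1` for odd `s`. -/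
def specialStep (s m : ℕ) : ℤ := m * (2 * (s / 2 : ℕ) + 1 - s) - 1

theorem specialStep_of_even (hs : Even s) : specialStep s m = m - 1 := by
  obtain ⟨u, rfl⟩ := hs
  rw [specialStep, ← two_mul, Nat.mul_div_cancel_left u two_pos]
  push_cast
  ring

theorem specialStep_of_odd (hs : Odd s) : specialStep s m = -1 := by
  obtain ⟨u, rfl⟩ := hs
  rw [specialStep, show (2 * u + 1) / 2 = u by omega]
  push_cast
  ring

theorem neg_le_specialStep (s : ℕ) (hm : 0 < m) : -(m : ℤ) ≤ specialStep s m := by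
  rcases s.even_or_odd with hs | hs
  · rw [specialStep_of_even hs]
    omega
  · rw [specialStep_of_odd hs]
    omega

theorem specialStep_lt (s m : ℕ) : specialStep s m < m := by
  rcases s.even_or_odd with hs | hs
  · rw [specialStep_of_even hs]
    omega
  · rw [specialStep_of_odd hs]
    omega

/-- The least energy on `boxSlice (Fin s) m (-1)`: that of a spike for which `Q` and
`insert z Q` are intervals. -/
def minEnergy (s m : ℕ) : ℤ :=
  -(m * (m * s + 2) * rowSum s)
    + (2 * m * (m + specialStep s m) * arcEnergy s (s / 2)
      + 2 * m * (m - specialStep s m) * arcEnergy s (s / 2 + 1))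

theorem spike_mem_boxSlice (hm : 0 < m) {z : Fin s} {Q : Finset (Fin s)} (hz : z ∉ Q)
    (hQ : Q.card = s / 2) : spike m (specialStep s m) z Q ∈ boxSlice (Fin s) m (-1) := by
  refine ⟨fun i => ?_, ?_⟩
  · rw [spike]
    split_ifs
    · exact abs_le.2 ⟨neg_le_specialStep s hm, (specialStep_lt s m).le⟩
    · rw [abs_neg, Nat.abs_cast]
    · rw [Nat.abs_cast]
  · rw [sum_spike hz, hQ, specialStep]
    ring

theorem exists_eq_spike {e : Fin s → ℤ} (he : e ∈ boxSlice (Fin s) m (-1)) {z : Fin s}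
    (hz : e z < m) (habs : ∀ i ≠ z, |e i| = m) :
    ∃ Q : Finset (Fin s), z ∉ Q ∧ Q.card = s / 2 ∧ e = spike m (specialStep s m) z Q := by
  set Q : Finset (Fin s) := {i | i ≠ z ∧ e i = -m}
  have hzQ : z ∉ Q := by simp [Q]
  have heq : e = spike m (e z) z Q := by
    ext i
    rw [spike]
    split_ifs with hiz hiQ
    · rw [hiz]
    · exact (Finset.mem_filter.1 hiQ).2.2
    · exact ((abs_eq m.cast_nonneg).1 (habs i hiz)).resolve_right
        fun h => hiQ (Finset.mem_filter.2 ⟨Finset.mem_univ i, hiz, h⟩)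
  have hsum : (m : ℤ) * (s - 1 - 2 * Q.card) + e z = -1 := by
    rw [← sum_spike hzQ, ← heq, he.2]
  have hlower := (abs_le.1 (he.1 z)).1
  have hcard : Q.card = s / 2 := by
    have : (s : ℤ) - 1 - 2 * Q.card < 1 := by
      by_contra! h
      nlinarith
    have : -1 ≤ (s : ℤ) - 1 - 2 * Q.card := by
      by_contra! h
      nlinarith
    omega
  refine ⟨Q, hzQ, hcard, heq.trans ?_⟩
  congr 1
  rw [specialStep, ← hcard]
  linear_combination hsum

theorem exists_eq_spike_of_isMinOn {e : Fin s → ℤ} (he : e ∈ boxSlice (Fin s) m (-1))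
    (hmin : IsMinOn (energy s) (boxSlice (Fin s) m (-1)) e) :
    ∃ z, ∃ Q : Finset (Fin s), z ∉ Q ∧ Q.card = s / 2 ∧ e = spike m (specialStep s m) z Q := by
  obtain ⟨z, hz, habs⟩ : ∃ z, e z < m ∧ ∀ i ≠ z, |e i| = m := by
    by_cases h : ∃ z, |e z| ≠ m
    · obtain ⟨z, hz⟩ := h
      refine ⟨z, (abs_lt.1 ((he.1 z).lt_of_ne hz)).2, fun i hi => ?_⟩
      exact (abs_eq_or_abs_eq_of_isMinOn (B := form s) he hmin hi
        (energy_single_sub_single hi)).resolve_right hz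
    · push Not at h
      obtain ⟨z, -, hz⟩ : ∃ z ∈ Finset.univ, e z < 0 :=
        Finset.exists_lt_of_sum_lt (by rw [he.2, Finset.sum_const_zero]; decide)
      exact ⟨z, by omega, fun i _ => h i⟩
  exact ⟨z, exists_eq_spike he hz habs⟩

theorem energy_spike_specialStep {z : Fin s} {Q : Finset (Fin s)} (hm : 0 < m) (hz : z ∉ Q)
    (hQ : Q.card = s / 2) : energy s (spike m (specialStep s m) z Q) = minEnergy s m
      + (2 * m * (m + specialStep s m) * (energy s (ind Q) - arcEnergy s (s / 2))
        + 2 * m * (m - specialStep s m)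
          * (energy s (ind (insert z Q)) - arcEnergy s (s / 2 + 1))) := by
  rw [energy_spike hz (spike_mem_boxSlice hm hz hQ).2, minEnergy]
  ring

theorem minEnergy_le_energy (hm : 0 < m) {e : Fin s → ℤ} (he : e ∈ boxSlice (Fin s) m (-1)) :
    minEnergy s m ≤ energy s e := by
  obtain ⟨x, hx, hmin⟩ := Set.exists_min_image _ (energy s) finite_boxSlice ⟨e, he⟩
  refine le_trans ?_ (hmin e he)
  obtain ⟨z, Q, hz, hQ, rfl⟩ := exists_eq_spike_of_isMinOn hx hmin
  rw [energy_spike_specialStep hm hz hQ]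
  have hQ' := arcEnergy_le_energy_ind Q
  have hzQ := arcEnergy_le_energy_ind (insert z Q)
  have := neg_le_specialStep s hm
  have := specialStep_lt s m
  rw [Finset.card_insert_of_notMem hz, hQ] at hzQ
  rw [hQ] at hQ'
  refine le_add_of_nonneg_right (add_nonneg ?_ ?_) <;>
    exact mul_nonneg (mul_nonneg (by positivity) (by omega)) (by omega)

theorem exists_eq_spike_of_energy_eq (hm : 0 < m) {e : Fin s → ℤ}
    (he : e ∈ boxSlice (Fin s) m (-1)) (h : energy s e = minEnergy s m) :
    ∃ z, ∃ Q : Finset (Fin s), z ∉ Q ∧ Q.card = s / 2 ∧ e = spike m (specialStep s m) z Q ∧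
      energy s (ind (insert z Q)) = arcEnergy s (s / 2 + 1) ∧
      (specialStep s m = -m ∨ energy s (ind Q) = arcEnergy s (s / 2)) := by
  obtain ⟨z, Q, hz, hQ, rfl⟩ :=
    exists_eq_spike_of_isMinOn he fun x hx => h.trans_le (minEnergy_le_energy hm hx)
  refine ⟨z, Q, hz, hQ, rfl, ?_⟩
  rw [energy_spike_specialStep hm hz hQ, add_eq_left] at h
  have hQ' := arcEnergy_le_energy_ind Q
  have hzQ := arcEnergy_le_energy_ind (insert z Q)
  have := neg_le_specialStep s hm
  have := specialStep_lt s m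
  rw [Finset.card_insert_of_notMem hz, hQ] at hzQ
  rw [hQ] at hQ'
  obtain ⟨h1, h2⟩ := (add_eq_zero_iff_of_nonneg
    (mul_nonneg (mul_nonneg (by positivity) (by omega)) (by omega))
    (mul_nonneg (mul_nonneg (by positivity) (by omega)) (by omega))).1 h
  have hm' : (2 * m : ℤ) ≠ 0 := by omega
  simp only [mul_eq_zero, hm', false_or] at h1 h2
  omega

end Minimum

section Tent

variable {s m : ℕ}

/-- Steps `m` on the first half of the positions and `-m` on the second half, except for the special
step at `z`. -/
def tent (s m z : ℕ) (i : Fin s) : ℤ :=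
  if (i : ℕ) = z then specialStep s m else if (i : ℕ) < s / 2 then m else -m

/-- The position of the special step of the core with `β`-set `bigL m s`. -/
def apex (s : ℕ) : ℕ := s - 1 - s / 2

/-- The position of the special step of the conjugate of the core with `β`-set `bigL m s`. -/
def foot (s : ℕ) : ℕ := if Even s then 0 else s - 1

theorem spike_eq_tent {z : Fin s} {Q : Finset (Fin s)} (h : ∀ i ≠ z, i ∈ Q ↔ s / 2 ≤ i) :
    spike m (specialStep s m) z Q = tent s m z := by
  ext i
  rw [spike, tent]
  rcases eq_or_ne i z with rfl | hiz
  · rw [if_pos rfl, if_pos rfl]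
  · rw [if_neg hiz, if_neg (Fin.val_ne_of_ne hiz)]
    simp only [h i hiz, ← not_lt, ite_not]

theorem apex_lt (hs : 0 < s) : apex s < s := by
  rw [apex]
  omega

theorem apex_notMem (hs : 0 < s) :
    ⟨apex s, apex_lt hs⟩ ∉ ({i | s ≤ i + s / 2} : Finset (Fin s)) := by
  simp only [Finset.mem_filter_univ, apex]
  omega

theorem tent_apex_eq_spike (hs : 0 < s) :
    tent s m (apex s) = spike m (specialStep s m) ⟨apex s, apex_lt hs⟩
      ({i | s ≤ i + s / 2} : Finset (Fin s)) := by
  refine (spike_eq_tent (z := ⟨apex s, apex_lt hs⟩) fun i hi => ?_).symm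
  have := Fin.val_ne_of_ne hi
  simp only [Finset.mem_filter_univ, apex] at *
  omega

theorem card_final {k : ℕ} (hk : k ≤ s) :
    ({i | s ≤ i + k} : Finset (Fin s)).card = k := by
  obtain ⟨a, rfl⟩ := Nat.exists_eq_add_of_le' hk
  have hlt (i : Fin a) : ¬ a ≤ (i : ℕ) := i.2.not_ge
  rw [Finset.card_filter, Fin.sum_univ_add]
  simp [hlt]

theorem tent_apex_mem_boxSlice (hs : 0 < s) (hm : 0 < m) :
    tent s m (apex s) ∈ boxSlice (Fin s) m (-1) := by
  rw [tent_apex_eq_spike hs]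
  exact spike_mem_boxSlice hm (apex_notMem hs) (card_final (Nat.div_le_self s 2))

theorem energy_tent_apex (hs : 0 < s) (hm : 0 < m) :
    energy s (tent s m (apex s)) = minEnergy s m := by
  have hinsert : insert ⟨apex s, apex_lt hs⟩ ({i | s ≤ i + s / 2} : Finset (Fin s))
      = ({i | s ≤ i + (s / 2 + 1)} : Finset (Fin s)) := by
    ext i
    simp only [Finset.mem_insert, Finset.mem_filter_univ, Fin.ext_iff, apex]
    omega
  rw [tent_apex_eq_spike hs, energy_spike_specialStep hm (apex_notMem hs) (card_final (by omega)),
    hinsert, energy_ind_final (by omega), energy_ind_final (by omega)]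
  ring

section Classification

variable {a b z : Fin s} {Q : Finset (Fin s)} (ha : (a : ℕ) = 0) (hb : (b : ℕ) + 1 = s)
  (hz : z ∉ Q) (hQ : Q.card = s / 2)
  (hinsert : energy s (ind (insert z Q)) = arcEnergy s (s / 2 + 1)) (haQ : a ∉ Q)
include ha hb hz hQ hinsert haQ

theorem spike_eq_tent_of_even (hs : Even s) (hQE : energy s (ind Q) = arcEnergy s (s / 2))
    (hbQ : b ∈ Q) : spike m (specialStep s m) z Q = tent s m (apex s) ∨
      spike m (specialStep s m) z Q = tent s m (foot s) := by
  obtain ⟨u, hu⟩ := hs.two_dvd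
  rw [← hQ] at hQE
  have hfinal := eq_final_of_energy_ind_eq ha hb hQE haQ hbQ
  have hmem (i : Fin s) : i ∈ Q ↔ s / 2 ≤ i := by
    rw [hfinal, Finset.mem_filter_univ, hQ]
    omega
  rw [spike_eq_tent fun i _ => hmem i]
  by_cases hza : z = a
  · rw [foot, if_pos hs, hza, ha]
    exact Or.inr rfl
  · have hcard : (insert z Q).card = s / 2 + 1 := by rw [Finset.card_insert_of_notMem hz, hQ]
    rw [← hcard] at hinsert
    have hfinal' := eq_final_of_energy_ind_eq ha hb hinsert
      (by rw [Finset.mem_insert]; tauto) (Finset.mem_insert_of_mem hbQ)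
    have hzmem := hfinal' ▸ Finset.mem_insert_self z Q
    rw [Finset.mem_filter_univ, hcard] at hzmem
    rw [hmem] at hz
    left
    congr 1
    rw [apex]
    omega

theorem spike_eq_tent_of_odd (hs : Odd s)
    (hQE : specialStep s m = -m ∨ energy s (ind Q) = arcEnergy s (s / 2))
    (hza : z ≠ a) (hbQ : b ∈ insert z Q) :
    spike m (specialStep s m) z Q = tent s m (apex s) ∨
      spike m (specialStep s m) z Q = tent s m (foot s) := by
  obtain ⟨u, hu⟩ := hs
  have hcard : (insert z Q).card = s / 2 + 1 := by rw [Finset.card_insert_of_notMem hz, hQ]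
  rw [← hcard] at hinsert
  have hfinal := eq_final_of_energy_ind_eq ha hb hinsert (by rw [Finset.mem_insert]; tauto) hbQ
  have hmem (i : Fin s) : i = z ∨ i ∈ Q ↔ s / 2 ≤ i := by
    rw [← Finset.mem_insert, hfinal, Finset.mem_filter_univ, hcard]
    omega
  have hmemQ : ∀ i ≠ z, i ∈ Q ↔ s / 2 ≤ i := fun i hi => by
    rw [← hmem, or_iff_right hi]
  rw [spike_eq_tent hmemQ]
  rcases hQE with hm | hQE
  · have hz' := (hmem z).1 (Or.inl rfl)
    left
    ext i
    simp only [tent, apex, hm]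
    split_ifs <;> omega
  · by_cases hzb : z = b
    · rw [foot, if_neg (Nat.not_even_iff_odd.2 ⟨u, hu⟩), hzb, ← Nat.sub_eq_of_eq_add hb.symm]
      exact Or.inr rfl
    · have hbQ' := (Finset.mem_insert.1 hbQ).resolve_left (Ne.symm hzb)
      rw [← hQ] at hQE
      have hfinal' := eq_final_of_energy_ind_eq ha hb hQE haQ hbQ'
      have hz' := (hmem z).1 (Or.inl rfl)
      rw [hfinal', Finset.mem_filter_univ, hQ] at hz
      left
      congr 1
      rw [apex]
      omega

end Classification

theorem eq_tent_of_energy_eq (hm : 0 < m) {e : Fin s → ℤ} (he : e ∈ boxSlice (Fin s) m (-1))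
    (h : energy s e = minEnergy s m) {a b : Fin s} (ha : (a : ℕ) = 0) (hb : (b : ℕ) + 1 = s)
    (hea : 0 ≤ e a) (heb : e b < 0) : e = tent s m (apex s) ∨ e = tent s m (foot s) := by
  obtain ⟨z, Q, hz, hQ, rfl, hinsert, hQE⟩ := exists_eq_spike_of_energy_eq hm he h
  have haQ : a ∉ Q := fun haQ => by
    rw [spike, if_neg (ne_of_mem_of_not_mem haQ hz), if_pos haQ] at hea
    omega
  have hbQ : b ∈ insert z Q := by
    by_contra hbQ
    rw [Finset.mem_insert, not_or] at hbQ
    rw [spike, if_neg hbQ.1, if_neg hbQ.2] at heb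
    omega
  rcases s.even_or_odd with hs | hs
  · have hc := specialStep_of_even (m := m) hs
    refine spike_eq_tent_of_even ha hb hz hQ hinsert haQ hs (hQE.resolve_left (by omega)) ?_
    refine (Finset.mem_insert.1 hbQ).resolve_left fun hbz => ?_
    rw [spike, if_pos hbz] at heb
    omega
  · refine spike_eq_tent_of_odd ha hb hz hQ hinsert haQ hs hQE (fun hza => ?_) hbQ
    rw [spike, if_pos hza.symm, specialStep_of_odd hs] at hea
    omega

theorem tent_apex_eq_tent_foot (h : s < 3 ∨ m = 1 ∧ Odd s) :
    tent s m (apex s) = tent s m (foot s) := by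
  ext i
  rcases h with hs | ⟨rfl, hs⟩
  · rcases s.even_or_odd with hs' | hs'
    · simp only [foot, if_pos hs', apex, show s - 1 - s / 2 = 0 by omega]
    · obtain ⟨u, hu⟩ := hs'
      have hodd : ¬ Even s := Nat.not_even_iff_odd.2 ⟨u, hu⟩
      simp only [foot, if_neg hodd, apex, show s - 1 - s / 2 = s - 1 by omega]
  · obtain ⟨u, hu⟩ := id hs
    simp only [tent, specialStep_of_odd hs, foot, if_neg (Nat.not_even_iff_odd.2 hs), apex]
    split_ifs <;> omega

end Tent

section Pyramids

variable {s m : ℕ}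

/-- The numbers of beads on the runners of the `s`-abacus with bead set `bigL m s`. -/
def maxCount (s m r : ℕ) : ℕ := min (r * m) ((s - r) * m - 1)

theorem mem_pyramid_iff {c d x : ℕ} : x ∈ pyramid (m * s) (c * s + 1) ((c + 1) * s - d) ↔
    ∃ i r, i + 1 ≤ r ∧ i + r + d ≤ s ∧ x = s * (m * i + c) + r := by
  simp only [pyramid, Set.mem_ofPred_eq, add_mul, one_mul]
  constructor
  · rintro ⟨i, j, hij, hji, rfl⟩
    refine ⟨i, j - c * s, by omega, by omega, ?_⟩
    have hj : c * s + (j - c * s) = j := by omega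
    linear_combination -hj
  · rintro ⟨i, r, hir, hri, rfl⟩
    exact ⟨i, c * s + r, by omega, by omega, by ring⟩

theorem mem_bigL_iff (hm : 0 < m) {x : ℕ} : x ∈ bigL m s ↔ ∃ i c r, c < m ∧
    i + 1 ≤ r ∧ i + r < s ∧ (c + 1 = m → i + r + 1 < s) ∧ x = s * (m * i + c) + r := by
  have hlast : pyramid (m * s) ((m - 1) * s + 1) (m * s - 2)
      = pyramid (m * s) ((m - 1) * s + 1) ((m - 1 + 1) * s - 2) := by
    rw [Nat.sub_add_cancel hm]
  simp only [bigL, Set.mem_union, Set.mem_iUnion, Finset.mem_Icc, exists_prop, hlast,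
    mem_pyramid_iff]
  constructor
  · rintro (⟨k, ⟨hk1, hkm⟩, hx⟩ | ⟨i, r, hir, hri, hx⟩)
    · obtain ⟨c, rfl⟩ := Nat.exists_eq_add_of_le' hk1
      obtain ⟨i, r, hir, hri, hx⟩ := mem_pyramid_iff.1 hx
      exact ⟨i, c, r, by omega, hir, hri, by omega, hx⟩
    · exact ⟨i, m - 1, r, by omega, hir, by omega, by omega, hx⟩
  · rintro ⟨i, c, r, hc, hir, hri, hlast, hx⟩
    by_cases hcm : c + 1 = m
    · obtain rfl : c = m - 1 := by omega
      exact Or.inr ⟨i, r, hir, hlast hcm, hx⟩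
    · exact Or.inl ⟨c + 1, by omega, mem_pyramid_iff.2 ⟨i, r, hir, hri, hx⟩⟩

theorem mul_add_lt_maxCount_iff {i c r : ℕ} (hc : c < m) : m * i + c < maxCount s m r ↔
    i + 1 ≤ r ∧ i + r < s ∧ (c + 1 = m → i + r + 1 < s) := by
  have hm : 0 < m := hc.pos
  have hleft : m * i + c < r * m ↔ i + 1 ≤ r := by
    rw [← Nat.div_lt_iff_lt_mul hm, Nat.mul_add_div hm, Nat.div_eq_of_lt hc]
    omega
  have hright : m * i + c + 1 < (s - r) * m ↔ i + r < s ∧ (c + 1 = m → i + r + 1 < s) := by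
    rw [← Nat.div_lt_iff_lt_mul hm, add_assoc, Nat.mul_add_div hm]
    rcases (show c + 1 ≤ m from hc).eq_or_lt with hcm | hcm
    · rw [hcm, Nat.div_self hm]
      omega
    · rw [Nat.div_eq_of_lt hcm]
      omega
  rw [maxCount, lt_min_iff, hleft, ← hright]
  omega

theorem coe_abacus_maxCount (hs : 0 < s) (hm : 0 < m) :
    (abacus s (maxCount s m) : Set ℕ) = bigL m s := by
  ext x
  rw [Finset.mem_coe, mem_bigL_iff hm]
  constructor
  · intro hx
    rw [← Nat.div_add_mod x s, mul_add_mem_abacus (Nat.mod_lt x hs), ← Nat.div_add_mod (x / s) m,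
      mul_add_lt_maxCount_iff (Nat.mod_lt _ hm)] at hx
    refine ⟨x / s / m, x / s % m, x % s, Nat.mod_lt _ hm, hx.1, hx.2.1, hx.2.2, ?_⟩
    rw [Nat.div_add_mod, Nat.div_add_mod]
  · rintro ⟨i, c, r, hc, hir, hri, hlast, rfl⟩
    exact (mul_add_mem_abacus (by omega)).2 ((mul_add_lt_maxCount_iff hc).2 ⟨hir, hri, hlast⟩)

theorem maxCount_zero (s m : ℕ) : maxCount s m 0 = 0 := by
  rw [maxCount, zero_mul, Nat.zero_min]

theorem maxCount_le (r : ℕ) : maxCount s m r ≤ s / 2 * m := by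
  rcases le_or_gt r (s / 2) with hr | hr
  · exact (min_le_left _ _).trans (Nat.mul_le_mul_right m hr)
  · exact (min_le_right _ _).trans
      ((Nat.sub_le _ _).trans (Nat.mul_le_mul_right m (by omega)))

theorem height_maxCount_of_lt (hm : 0 < m) {r : ℕ} (h : 2 * r < s) :
    height s (maxCount s m) r = r * m := by
  have hle : (r + 1) * m ≤ (s - r) * m := Nat.mul_le_mul_right m (by omega)
  rw [add_mul, one_mul] at hle
  rw [height_of_lt (by omega), maxCount, min_eq_left (by omega), Nat.cast_mul]

theorem height_maxCount_of_le (hm : 0 < m) {r : ℕ} (h : s ≤ 2 * r) (hr : r ≤ s) :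
    height s (maxCount s m) r = (s - r) * m - 1 := by
  rcases hr.lt_or_eq with hr | rfl
  · have hle : (s - r) * m ≤ r * m := Nat.mul_le_mul_right m (by omega)
    have hpos : 1 ≤ (s - r) * m := Nat.mul_pos (by omega) hm
    rw [height_of_lt hr, maxCount, min_eq_right (by omega), Nat.cast_sub hpos, Nat.cast_mul,
      Nat.cast_sub hr.le, Nat.cast_one]
  · rw [height_self, sub_self, zero_mul, zero_sub]

theorem steps_maxCount (hm : 0 < m) : steps s (maxCount s m) = tent s m (apex s) := by
  ext i
  rw [steps, tent, apex]
  split_ifs with hi hi'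
  · rw [height_maxCount_of_le hm (by omega) i.2, height_maxCount_of_lt hm (by omega), specialStep]
    have : ((i : ℕ) : ℤ) = s - 1 - (s / 2 : ℕ) := by omega
    push_cast [this]
    ring
  · rw [height_maxCount_of_lt hm (by omega), height_maxCount_of_lt hm (by omega)]
    push_cast
    ring
  · rw [height_maxCount_of_le hm (by omega) i.2, height_maxCount_of_le hm (by omega) i.2.le]
    push_cast
    ring

theorem maxCount_add_maxCount (hm : 0 < m) {r : ℕ} (hr : r < s / 2) :
    maxCount s m r + maxCount s m ((s + 1) / 2 + r) + 1 = s / 2 * m := by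
  have hlow := height_maxCount_of_lt (s := s) hm (r := r) (by omega)
  have hupp := height_maxCount_of_le (s := s) hm (r := (s + 1) / 2 + r) (by omega) (by omega)
  rw [height_of_lt (by omega)] at hlow hupp
  have hrow : (s : ℤ) - ((s + 1) / 2 + r : ℕ) = (s / 2 : ℕ) - r := by omega
  rw [hrow] at hupp
  refine Nat.cast_injective (R := ℤ) ?_
  rw [Nat.cast_add, Nat.cast_add, hlow, hupp, Nat.cast_mul, Nat.cast_one]
  ring

theorem sum_maxCount_add_maxCount (hm : 0 < m) :
    ∑ r ∈ Finset.range (s / 2), maxCount s m r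
      + ∑ r ∈ Finset.range (s / 2), maxCount s m ((s + 1) / 2 + r) + s / 2
      = s / 2 * (s / 2 * m) := by
  have hpair := Finset.sum_congr rfl fun r hr =>
    maxCount_add_maxCount (s := s) hm (Finset.mem_range.1 hr)
  simpa only [Finset.sum_add_distrib, Finset.sum_const, Finset.card_range, smul_eq_mul, mul_one]
    using hpair

theorem sum_maxCount_even (hm : 0 < m) (u : ℕ) :
    ∑ r ∈ Finset.range (2 * u), maxCount (2 * u) m r + u = u * (u * m) := by
  have h := sum_maxCount_add_maxCount (s := 2 * u) hm
  rw [show 2 * u / 2 = u by omega, show (2 * u + 1) / 2 = u by omega] at h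
  rw [← h, ← Finset.sum_range_add, two_mul]

theorem sum_maxCount_odd (hm : 0 < m) (u : ℕ) :
    ∑ r ∈ Finset.range (2 * u + 1), maxCount (2 * u + 1) m r + u = u * (u * m) + u * m := by
  have h := sum_maxCount_add_maxCount (s := 2 * u + 1) hm
  have hmid := height_maxCount_of_lt (s := 2 * u + 1) hm (r := u) (by omega)
  rw [height_of_lt (by omega)] at hmid
  norm_cast at hmid
  rw [show (2 * u + 1) / 2 = u by omega, show (2 * u + 1 + 1) / 2 = u + 1 by omega] at h
  rw [← h, ← hmid, show Finset.range (2 * u + 1) = Finset.range (u + 1 + u) by congr 1; ring,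
    Finset.sum_range_add, Finset.sum_range_succ]
  ring

end Pyramids

section Conjugation

variable {s m : ℕ} {μ : YoungDiagram}

-- The largest first-column hook length of a self-conjugate `μ` is `2 * μ.colLen 0 - 1`.
theorem mem_abacus_of_transpose_eq {n : ℕ → ℕ} (hμ : betaSet μ = abacus s n)
    (h : μ.transpose = μ) {x : ℕ} (hx : x + 1 = 2 * ∑ r ∈ Finset.range s, n r) :
    x ∈ abacus s n := by
  have hrow : μ.rowLen 0 = μ.colLen 0 := by rw [← YoungDiagram.colLen_transpose, h]
  have hcol : μ.colLen 0 = ∑ r ∈ Finset.range s, n r := by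
    rw [← card_betaSet, hμ, card_abacus]
  rw [← hμ, mem_betaSet]
  exact ⟨0, by omega, by omega⟩

theorem transpose_ne_of_even {u : ℕ} (hu : 2 ≤ u) (hm : 0 < m)
    (hμ : betaSet μ = abacus (2 * u) (maxCount (2 * u) m)) : μ.transpose ≠ μ := fun h => by
  have hum : 2 * m ≤ u * m := Nat.mul_le_mul_right m hu
  have hmem := mem_abacus_of_transpose_eq hμ h (x := 2 * u * (u * m - 2) + (2 * u - 1)) <| by
    have := sum_maxCount_even hm u
    zify [show 2 ≤ u * m by omega, show 1 ≤ 2 * u by omega] at this ⊢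
    linear_combination -2 * this
  rw [mul_add_mem_abacus (by omega), maxCount, lt_min_iff, Nat.sub_sub_self (by omega),
    one_mul] at hmem
  omega

theorem transpose_ne_of_odd {u : ℕ} (hu : 1 ≤ u) (hm : 2 ≤ m)
    (hμ : betaSet μ = abacus (2 * u + 1) (maxCount (2 * u + 1) m)) : μ.transpose ≠ μ := fun h => by
  have hum : 1 * m ≤ u * m := Nat.mul_le_mul_right m hu
  have hum' : u * 2 ≤ u * m := Nat.mul_le_mul_left u hm
  have hmem := mem_abacus_of_transpose_eq hμ h (x := (2 * u + 1) * (u * m - 1) + u * m) <| by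
    have := sum_maxCount_odd (show 0 < m by omega) u
    zify [show 1 ≤ u * m by omega] at this ⊢
    linear_combination -2 * this
  rw [← Nat.div_add_mod (u * m) (2 * u + 1), ← add_assoc, ← mul_add, Nat.div_add_mod,
    mul_add_mem_abacus (Nat.mod_lt _ (by omega))] at hmem
  rcases lt_or_ge (u * m) (2 * u + 1) with hlt | hge
  · rw [Nat.mod_eq_of_lt hlt, Nat.div_eq_of_lt hlt, maxCount, lt_min_iff,
      show 2 * u + 1 - u * m = 1 by omega, one_mul] at hmem
    omega
  · have hq : 0 < u * m / (2 * u + 1) := Nat.div_pos hge (by omega)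
    have := maxCount_le (s := 2 * u + 1) (m := m) (u * m % (2 * u + 1))
    rw [show (2 * u + 1) / 2 = u by omega] at this
    omega

theorem transpose_ne (hm : 0 < m) (hμ : betaSet μ = abacus s (maxCount s m)) (hs : 3 ≤ s)
    (h : 2 ≤ m ∨ Even s) : μ.transpose ≠ μ := by
  rcases s.even_or_odd' with ⟨u, rfl | rfl⟩
  · exact transpose_ne_of_even (by omega) hm hμ
  · exact transpose_ne_of_odd (by omega) (h.resolve_right (by simp)) hμ

end Conjugation

section Largest

variable {s m : ℕ} {μ lam : YoungDiagram}

theorem six_mul_neg_minEnergy_odd (m u : ℕ) : 6 * -minEnergy (2 * u + 1) m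
    = 4 * ((m : ℤ) ^ 2 * (u + 1) * u * ((u + 1) ^ 2 - (u + 1) + 1)) := by
  have hrow := six_mul_rowSum (2 * u + 1)
  have harc := six_mul_arcEnergy (2 * u + 1) u
  have harc' := six_mul_arcEnergy (2 * u + 1) (u + 1)
  rw [minEnergy, specialStep_of_odd (odd_two_mul_add_one u), show (2 * u + 1) / 2 = u by omega]
  push_cast at hrow harc harc' ⊢
  linear_combination (m * (m * (2 * u + 1) + 2) : ℤ) * hrow - 2 * m * (m - 1) * harc
    - 2 * m * (m + 1) * harc'

theorem six_mul_neg_minEnergy_even (m u : ℕ) : 6 * -minEnergy (2 * u) m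
    = 4 * ((m : ℤ) ^ 2 * u ^ 2 * (u ^ 2 + 2)) - 12 * (m * u ^ 2) := by
  have hrow := six_mul_rowSum (2 * u)
  have harc := six_mul_arcEnergy (2 * u) u
  have harc' := six_mul_arcEnergy (2 * u) (u + 1)
  rw [minEnergy, specialStep_of_even (even_two_mul u), Nat.mul_div_cancel_left u two_pos]
  push_cast at hrow harc harc' ⊢
  linear_combination (m * (m * (2 * u) + 2) : ℤ) * hrow - 2 * m * (2 * m - 1) * harc
    - 2 * m * harc'

theorem steps_mem_boxSlice {n : ℕ → ℕ} (hs : 0 < s) (hm : 0 < m) (h0 : n 0 = 0)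
    (hμ : betaSet μ = abacus s n) (hcore : μ ∈ cores s m) :
    steps s n ∈ boxSlice (Fin s) m (-1) :=
  ⟨(mem_cores_iff hs hm h0 hμ).1 hcore, sum_steps hs h0⟩

theorem four_mul_card_le (hs : 0 < s) (hm : 0 < m) (hμ : μ ∈ cores s m) :
    4 * (μ.card : ℤ) ≤ -minEnergy s m := by
  obtain ⟨n, h0, hn⟩ := exists_betaSet_eq_abacus hs hμ
  have := minEnergy_le_energy hm (steps_mem_boxSlice hs hm h0 hn hμ)
  rw [energy_steps hs h0 hn] at this
  omega

theorem exists_betaSet_eq_abacus_maxCount (hs : 0 < s) (m : ℕ) :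
    ∃ lam, betaSet lam = abacus s (maxCount s m) :=
  exists_betaSet_eq fun h => by
    simpa [maxCount_zero] using (mul_add_mem_abacus (k := 0) hs).1 h

theorem mem_cores_of_betaSet_eq (hs : 0 < s) (hm : 0 < m)
    (hlam : betaSet lam = abacus s (maxCount s m)) : lam ∈ cores s m := by
  rw [mem_cores_iff hs hm (maxCount_zero s m) hlam, steps_maxCount hm]
  exact (tent_apex_mem_boxSlice hs hm).1

theorem four_mul_card_of_betaSet_eq (hs : 0 < s) (hm : 0 < m)
    (hlam : betaSet lam = abacus s (maxCount s m)) : 4 * (lam.card : ℤ) = -minEnergy s m := by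
  rw [← energy_tent_apex hs hm, ← steps_maxCount hm, energy_steps hs (maxCount_zero s m) hlam,
    neg_neg]

theorem isGreatest_card (hs : 0 < s) (hm : 0 < m) {v : ℚ} (hv : 4 * v = -minEnergy s m) :
    IsGreatest ((fun μ : YoungDiagram => (μ.card : ℚ)) '' cores s m) v := by
  constructor
  · obtain ⟨lam, hlam⟩ := exists_betaSet_eq_abacus_maxCount hs m
    have hcard : (4 * lam.card : ℚ) = -minEnergy s m :=
      mod_cast four_mul_card_of_betaSet_eq hs hm hlam
    exact ⟨lam, mem_cores_of_betaSet_eq hs hm hlam, by dsimp only; linarith⟩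
  · rintro _ ⟨μ, hμ, rfl⟩
    have hcard : (4 * μ.card : ℚ) ≤ -minEnergy s m := mod_cast four_mul_card_le hs hm hμ
    dsimp only
    linarith

theorem steps_eq_tent_or {n : ℕ → ℕ} (hs : 0 < s) (hm : 0 < m) (h0 : n 0 = 0)
    (hμ : betaSet μ = abacus s n) (hcore : μ ∈ cores s m)
    (hcard : 4 * (μ.card : ℤ) = -minEnergy s m) :
    steps s n = tent s m (apex s) ∨ steps s n = tent s m (foot s) := by
  have hmem := steps_mem_boxSlice hs hm h0 hμ hcore
  have henergy : energy s (steps s n) = minEnergy s m := by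
    rw [energy_steps hs h0 hμ, hcard, neg_neg]
  obtain rfl | hs1 := (show 1 ≤ s from hs).eq_or_lt
  · have hsum := hmem.2.trans (tent_apex_mem_boxSlice hs hm).2.symm
    rw [Fin.sum_univ_one, Fin.sum_univ_one] at hsum
    exact Or.inl (funext fun i => by rwa [Subsingleton.elim i 0])
  refine eq_tent_of_energy_eq hm hmem henergy (a := ⟨0, hs⟩) (b := ⟨s - 1, by omega⟩) rfl
    (Nat.sub_add_cancel hs) ?_ ?_
  · simp only [steps, zero_add, height_of_lt hs1, height_of_lt hs, h0]
    omega
  · simp only [steps, Nat.sub_add_cancel hs, height_self, height_of_lt (Nat.sub_one_lt_of_lt hs)]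
    omega

theorem eq_of_steps_eq {ν : YoungDiagram} {n k : ℕ → ℕ} (hn : n 0 = 0) (hk : k 0 = 0)
    (hμ : betaSet μ = abacus s n) (hν : betaSet ν = abacus s k) (h : steps s n = steps s k) :
    μ = ν :=
  betaSet_injective (by rw [hμ, hν, abacus_eq_of_steps_eq (hn.trans hk.symm) h])

theorem eq_or_eq_transpose (hs : 0 < s) (hm : 0 < m)
    (hlam : betaSet lam = abacus s (maxCount s m)) (hμ : μ ∈ cores s m)
    (hcard : μ.card = lam.card) : μ = lam ∨ μ = lam.transpose := by
  have hlamcard := four_mul_card_of_betaSet_eq hs hm hlam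
  have heq {ν : YoungDiagram} {k : ℕ → ℕ} (hk : k 0 = 0) (hν : betaSet ν = abacus s k)
      (hst : steps s k = tent s m (apex s)) : ν = lam :=
    eq_of_steps_eq hk (maxCount_zero s m) hν hlam (hst.trans (steps_maxCount hm).symm)
  obtain ⟨n, h0, hn⟩ := exists_betaSet_eq_abacus hs hμ
  obtain hapex | hfoot := steps_eq_tent_or hs hm h0 hn hμ (by rw [hcard, hlamcard])
  · exact Or.inl (heq h0 hn hapex)
  by_cases hdeg : s < 3 ∨ m = 1 ∧ Odd s
  · exact Or.inl (heq h0 hn (hfoot.trans (tent_apex_eq_tent_foot hdeg).symm))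
  push Not at hdeg
  have hne : lam.transpose ≠ lam := transpose_ne hm hlam hdeg.1 <| by
    rcases (show 1 ≤ m from hm).eq_or_lt with h1 | h2
    exacts [Or.inr (Nat.not_odd_iff_even.1 (hdeg.2 h1.symm)), Or.inl h2]
  have hcore := transpose_mem_cores (mem_cores_of_betaSet_eq hs hm hlam)
  obtain ⟨k, hk0, hk⟩ := exists_betaSet_eq_abacus hs hcore
  obtain hapex' | hfoot' := steps_eq_tent_or hs hm hk0 hk hcore (by rw [card_transpose, hlamcard])
  · exact absurd (heq hk0 hk hapex') hne
  · exact Or.inr (eq_of_steps_eq h0 hk0 hn hk (hfoot.trans hfoot'.symm))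

theorem setOf_largest_eq (hs : 0 < s) (hm : 0 < m)
    (hlam : betaSet lam = abacus s (maxCount s m)) :
    {μ | μ ∈ cores s m ∧ ∀ ν ∈ cores s m, ν.card ≤ μ.card} = {lam, lam.transpose} := by
  have hcore := mem_cores_of_betaSet_eq hs hm hlam
  have hle : ∀ ν ∈ cores s m, ν.card ≤ lam.card := fun ν hν => by
    have := four_mul_card_le hs hm hν
    have := four_mul_card_of_betaSet_eq hs hm hlam
    omega
  ext μ
  simp only [Set.mem_ofPred_eq, Set.mem_insert_iff, Set.mem_singleton_iff]
  constructor
  · exact fun ⟨hμ, hmax⟩ => eq_or_eq_transpose hs hm hlam hμ ((hle μ hμ).antisymm (hmax lam hcore))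
  · rintro (rfl | rfl)
    · exact ⟨hcore, hle⟩
    · exact ⟨transpose_mem_cores hcore, by simpa only [card_transpose] using hle⟩

theorem isGreatest_card_odd (hs : 0 < s) (hm : 0 < m) {t : ℕ} (ht : (s : ℤ) = 2 * t - 1) :
    IsGreatest ((fun μ : YoungDiagram => (μ.card : ℚ)) '' cores s m)
      ((m : ℚ) ^ 2 * t * (t - 1) * ((t : ℚ) ^ 2 - t + 1) / 6) := by
  refine isGreatest_card hs hm ?_
  obtain ⟨u, rfl⟩ : ∃ u, t = u + 1 := ⟨t - 1, by omega⟩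
  obtain rfl : s = 2 * u + 1 := by omega
  have hvalue := congrArg (Int.cast (R := ℚ)) (six_mul_neg_minEnergy_odd m u)
  push_cast at hvalue ⊢
  linear_combination -hvalue / 6

theorem isGreatest_card_even (hs : 0 < s) (hm : 0 < m) {t : ℕ} (ht : (s : ℤ) = 2 * t - 2) :
    IsGreatest ((fun μ : YoungDiagram => (μ.card : ℚ)) '' cores s m)
      ((m : ℚ) ^ 2 * ((t : ℚ) - 1) ^ 2 * ((t : ℚ) ^ 2 - 2 * t + 3) / 6
        - (m : ℚ) * ((t : ℚ) - 1) ^ 2 / 2) := by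
  refine isGreatest_card hs hm ?_
  obtain ⟨u, rfl⟩ : ∃ u, t = u + 1 := ⟨t - 1, by omega⟩
  obtain rfl : s = 2 * u := by omega
  have hvalue := congrArg (Int.cast (R := ℚ)) (six_mul_neg_minEnergy_even m u)
  push_cast at hvalue ⊢
  linear_combination -hvalue / 6

end Largest

end CorePartition

theorem theorem1p1 (s m : ℕ) (hs : 1 ≤ s) (hm : 1 ≤ m) :
    (∀ t : ℕ, (s : ℤ) = 2 * t - 1 →
      IsGreatest ((fun μ : YoungDiagram => (μ.card : ℚ)) '' CorePartition.cores s m)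
        ((m : ℚ) ^ 2 * t * (t - 1) * ((t : ℚ) ^ 2 - t + 1) / 6)) ∧
    (∀ t : ℕ, (s : ℤ) = 2 * t - 2 →
      IsGreatest ((fun μ : YoungDiagram => (μ.card : ℚ)) '' CorePartition.cores s m)
        ((m : ℚ) ^ 2 * ((t : ℚ) - 1) ^ 2 * ((t : ℚ) ^ 2 - 2 * t + 3) / 6
          - (m : ℚ) * ((t : ℚ) - 1) ^ 2 / 2)) ∧
    ∃ lam : YoungDiagram,
      (CorePartition.betaSet lam : Set ℕ) = CorePartition.bigL m s ∧
      {μ | μ ∈ CorePartition.cores s m ∧ ∀ ν ∈ CorePartition.cores s m, ν.card ≤ μ.card}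
        = {lam, lam.transpose} ∧
      (3 ≤ s → (2 ≤ m ∨ Even s) → lam.transpose ≠ lam) := by
  open CorePartition in
  obtain ⟨lam, hlam⟩ := exists_betaSet_eq_abacus_maxCount hs m
  exact ⟨fun t ht => isGreatest_card_odd hs hm ht, fun t ht => isGreatest_card_even hs hm ht,
    lam, by rw [hlam, coe_abacus_maxCount hs hm], setOf_largest_eq hs hm hlam,
    transpose_ne hm hlam⟩
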